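/- Let $r_1=2<r_2=3<r_3=5<\cdots$ be the sequence of all primes, let $\varphi$ be Euler's totient function, and let $r$ and $p$ denote primes. For every integer $m\ge 1$ the product \[ \sigma_m=\prod_{p}\left(1-\frac{p^m-(p-1)^m}{p^{m+1}-p^m}\right) \] converges, and $\sigma_m$ is the mean value of $(\varphi(r-1)/(r-1))^m$ over primes, i.e. \[ \lim_{k\to\infty}\frac1k\sum_{r\le r_k}\left(\frac{\varphi(r-1)}{r-1}\right)^m=\sigma_m. \] Moreover, there is a constant $\varrho>1$, given by $\log\varrho=\sum_{m=1}^{\infty}\sigma_m/m$ (a convergent series), such that \[ \prod_{r\le r_k}\left(1-\frac{\varphi(r-1)}{r}\right)=\varrho^{-(1+o(1))k}\qquad\text{as }k\to\infty. \] -/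

import Mathlib

open Filter Topology

/-- The `k`-th prime `r_k` in increasing order, indexed from `1`: `r_1 = 2`, `r_2 = 3`, `r_3 = 5`, …
(`Nat.nth` is indexed from `0`; only `k ≥ 1` is meaningful here). -/
noncomputable def kthPrime (k : ℕ) : ℕ := Nat.nth Nat.Prime (k - 1)

/-- The finite set of primes `r ≤ y`. -/
def primesUpTo (y : ℕ) : Finset ℕ := (Finset.Icc 1 y).filter Nat.Prime

/-- The Euler factor `1 - (p^m - (p-1)^m) / (p^(m+1) - p^m)` at the prime `p`. -/
noncomputable def sigmaFactor (m : ℕ) (p : Nat.Primes) : ℝ :=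
  1 - (((p : ℕ) : ℝ) ^ m - (((p : ℕ) : ℝ) - 1) ^ m) /
    (((p : ℕ) : ℝ) ^ (m + 1) - ((p : ℕ) : ℝ) ^ m)

/-- The Euler product `σ_m = ∏_p (1 - (p^m - (p-1)^m) / (p^(m+1) - p^m))` over all primes. -/
noncomputable def sigmaMoment (m : ℕ) : ℝ := ∏' p : Nat.Primes, sigmaFactor m p

/-!
The sums over primes reduce to the density of primes in the progressions `1` modulo `d`. With
`g(p) = (1 - 1/p) ^ m - 1`, the function `(φ(n) / n) ^ m` is the product of `1 + g(p)` over the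
primes `p ∣ n`. If only the primes `p ≤ z` are kept, the product expands into a finite combination of
the conditions `d ∣ r - 1`; each holds for a proportion `1 / φ(d)` of the primes `r`
(`tendsto_primesOneModCount_div`), so the truncated mean value is the partial Euler product of
`1 + g(p) / (p - 1)`, which is the factor of `σ_m` at `p` (`tendsto_truncated_average`).

The density comes from a Wiener–Ikehara theorem (`tendsto_sum_div_of_continuousOn_LSeries_sub`),
applied to the von Mangoldt function on a residue class, whose L-series minus its pole is continuous
on `Re s ≥ 1`. Its Tauberian core (`tendsto_of_continuousOn_laplace`) concerns a bounded
function `S` with `e ^ u * S u` monotone: Fejér averages of `S` converge by the Riemann–Lebesgue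
lemma, and monotonicity compares `S v` with averages over short windows next to `v`.

Dropping the primes `p > z` costs at most the mean over `r` of the sum of `m / p` over the `p > z`
that divide `r - 1`. This needs a bound for the number of primes `r ≡ 1 [MOD p]` up to `N` uniform in
`p`. Instead of a sieve, the proof uses an analogue of Chebyshev's argument: the part of `n !` prime
to `p` divides `∏ (p k + 1)` over `k ≤ n`, and so do the primes `r > n` in the progression; comparing
sizes gives a bound that loses only a factor `log p`, and the sum of `log p / p ^ 2` converges
(`exists_eventually_primesOneModCount_div_le`, `eventually_abs_average_sub_le`).

For the product over primes, `φ(r - 1) / r` has the same moments `σ_m` and is at most `1 / 2`. So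
`-log (1 - φ(r - 1) / r)` is expanded in powers, and its mean is the sum of `σ_m / m` by dominated
convergence (`tendsto_average_neg_log`). This sum is positive because the Euler product `σ_1`
converges absolutely with nonzero factors; its exponential is `ϱ`.
-/

/-! ### A Tauberian theorem via the Fejér kernel -/

section Tauberian

open MeasureTheory Set

/-- The Fejér kernel `(1 - cos w) / w ^ 2`, in the form of the cosine transform of the triangle
function; this form makes sense at `w = 0` too. -/
noncomputable def fejer (w : ℝ) : ℝ := ∫ t in (0 : ℝ)..1, (1 - t) * Real.cos (t * w)

lemma fejer_eq {w : ℝ} (hw : w ≠ 0) : fejer w = (1 - Real.cos w) / w ^ 2 := by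
  have h : ∀ t ∈ uIcc (0 : ℝ) 1, HasDerivAt
      (fun t => (1 - t) * Real.sin (t * w) / w - Real.cos (t * w) / w ^ 2)
      ((1 - t) * Real.cos (t * w)) t := by
    intro t _
    have h1 : HasDerivAt (fun t : ℝ => t * w) w t := by simpa using (hasDerivAt_id t).mul_const w
    have h2 : HasDerivAt (fun t : ℝ => 1 - t) (-1) t := by
      simpa using (hasDerivAt_id t).const_sub 1
    convert! ((h2.mul h1.sin).div_const w).sub (h1.cos.div_const (w ^ 2)) using 1
    field_simp
    ring
  rw [fejer, intervalIntegral.integral_eq_sub_of_hasDerivAt h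
    (Continuous.intervalIntegrable (by fun_prop) _ _)]
  simp
  ring

lemma continuous_fejer : Continuous fejer := by
  unfold fejer
  exact intervalIntegral.continuous_parametric_intervalIntegral_of_continuous' (by fun_prop) _ _

lemma fejer_zero : fejer 0 = 1 / 2 := by
  simp only [fejer, mul_zero, Real.cos_zero, mul_one]
  rw [intervalIntegral.integral_sub (by simp) (by simp)]
  norm_num

lemma fejer_nonneg (w : ℝ) : 0 ≤ fejer w := by
  rcases eq_or_ne w 0 with rfl | hw
  · simp [fejer_zero]
  · rw [fejer_eq hw]
    have := Real.cos_le_one w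
    positivity [sub_nonneg.2 this]

lemma fejer_le (w : ℝ) : fejer w ≤ 4 * (1 + w ^ 2)⁻¹ := by
  rcases eq_or_ne w 0 with rfl | hw
  · simp [fejer_zero]; norm_num
  · rw [fejer_eq hw, ← div_eq_mul_inv, div_le_div_iff₀ (by positivity) (by positivity)]
    have h1 := Real.one_sub_sq_div_two_le_cos (x := w)
    have h2 := Real.neg_one_le_cos w
    nlinarith [sq_nonneg w]

lemma integrable_fejer : Integrable fejer := by
  refine (integrable_inv_one_add_sq.const_mul 4).mono' continuous_fejer.aestronglyMeasurable ?_
  filter_upwards with w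
  rw [Real.norm_of_nonneg (fejer_nonneg w)]
  exact fejer_le w

lemma integral_fejer_pos : 0 < ∫ w, fejer w := by
  refine integral_pos_of_integrable_nonneg_nonzero (x := 0) continuous_fejer integrable_fejer
    fejer_nonneg ?_
  simp [fejer_zero]

lemma integrable_fejer_comp {l : ℝ} (hl : 0 < l) (v : ℝ) :
    Integrable fun u => fejer (l * (v - u)) := by
  have := (integrable_fejer.comp_mul_left' hl.ne').comp_sub_left v
  exact this

lemma integral_fejer_comp {l : ℝ} (hl : 0 < l) (v : ℝ) :
    ∫ u, fejer (l * (v - u)) = l⁻¹ * ∫ w, fejer w := by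
  rw [integral_sub_left_eq_self (fun u => fejer (l * u)) volume v,
    Measure.integral_comp_mul_left fejer l, abs_of_pos (by positivity), smul_eq_mul]

lemma integral_fejer_Icc {l : ℝ} (hl : 0 < l) (v δ : ℝ) :
    ∫ u in (v - δ)..(v + δ), fejer (l * (v - u)) =
      l⁻¹ * ∫ w in (-(l * δ))..(l * δ), fejer w := by
  rw [intervalIntegral.integral_comp_sub_left (fun u => fejer (l * u)) v,
    intervalIntegral.integral_comp_mul_left fejer hl.ne', smul_eq_mul]
  congr 2 <;> ring

lemma tendsto_integral_fejer_Ioi {l : ℝ} (hl : 0 < l) :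
    Tendsto (fun v => ∫ u in Ioi 0, fejer (l * (v - u))) atTop (𝓝 (l⁻¹ * ∫ w, fejer w)) := by
  have h1 : ∀ v, ∫ u in Ioi 0, fejer (l * (v - u)) = l⁻¹ * ∫ w in Iio (l * v), fejer w := by
    intro v
    rw [← integral_indicator measurableSet_Ioi, ← integral_indicator measurableSet_Iio]
    have h2 : (Ioi (0:ℝ)).indicator (fun u => fejer (l * (v - u))) =
        fun u => (Iio (l * v)).indicator fejer (l * (v - u)) := by
      ext u
      simp only [indicator, mem_Ioi, mem_Iio]
      congr 1
      simp only [eq_iff_iff]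
      rw [mul_lt_mul_iff_right₀ hl]
      constructor <;> intro h <;> linarith
    rw [h2, integral_sub_left_eq_self (fun u => (Iio (l * v)).indicator fejer (l * u)) volume v,
      Measure.integral_comp_mul_left _ l, abs_of_pos (by positivity), smul_eq_mul]
  simp_rw [h1]
  refine Tendsto.const_mul _ ?_
  have h3 : Tendsto (fun v : ℝ => l * v) atTop atTop := tendsto_id.const_mul_atTop hl
  have h4 : Tendsto (fun v : ℝ => ∫ w in Iic v, fejer w) atTop (𝓝 (∫ w, fejer w)) := by
    simpa using (aecover_Iic tendsto_id).integral_tendsto_of_countably_generated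
      (μ := volume) integrable_fejer
  refine (h4.comp h3).congr fun v => ?_
  simp [integral_Iic_eq_integral_Iio]

variable {B : ℝ → ℝ} {M : ℝ} {H : ℂ → ℂ}

/-- Inside the half-plane of convergence, a damped Fejér average of `B` is an integral of its Laplace
transform over a vertical segment. -/
lemma integral_mul_exp_mul_fejer (hB : Measurable B) (hM : ∀ u, 0 < u → |B u| ≤ M)
    (hH : ∀ s : ℂ, 0 < s.re → ∫ u in Ioi (0 : ℝ), (B u : ℂ) * Complex.exp (-s * u) = H s)
    {l : ℝ} (v : ℝ) {σ : ℝ} (hσ : 0 < σ) :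
    ∫ u in Ioi (0 : ℝ), B u * Real.exp (-σ * u) * fejer (l * (v - u)) =
      ∫ t in (0 : ℝ)..1, ((1 - t : ℝ) *
        (Complex.exp (Complex.I * (l * v * t : ℝ)) * H (σ + Complex.I * (l * t : ℝ)))).re := by
  have hexp : Integrable (fun u : ℝ => M * Real.exp (-σ * u)) (volume.restrict (Ioi 0)) :=
    (integrableOn_exp_mul_Ioi (by linarith) 0).const_mul M
  simp_rw [fejer, ← intervalIntegral.integral_const_mul]
  simp_rw [intervalIntegral.integral_of_le zero_le_one]
  rw [integral_integral_swap]
  · refine integral_congr_ae (Eventually.of_forall fun t => ?_)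
    simp only
    rw [← hH _ (by simpa using hσ), ← integral_const_mul, ← integral_const_mul]
    have key : ∀ u : ℝ, ((1 - t : ℝ) : ℂ) * (Complex.exp (Complex.I * (l * v * t : ℝ)) *
        ((B u : ℂ) * Complex.exp (-(σ + Complex.I * (l * t : ℝ)) * u))) =
        (((1 - t) * B u * Real.exp (-σ * u) : ℝ) : ℂ) *
          Complex.exp ((t * (l * (v - u)) : ℝ) * Complex.I) := by
      intro u
      push_cast
      have : Complex.exp (Complex.I * (l * v * t)) * Complex.exp (-(σ + Complex.I * (l * t)) * u)
          = Complex.exp (-σ * u) * Complex.exp (t * (l * (v - u)) * Complex.I) := by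
        rw [← Complex.exp_add, ← Complex.exp_add]
        congr 1
        ring
      linear_combination ((1 - t : ℂ)) * B u * this
    simp_rw [key]
    rw [← RCLike.re_eq_complex_re, ← integral_re]
    · refine integral_congr_ae (Eventually.of_forall fun u => ?_)
      simp only [RCLike.re_eq_complex_re]
      rw [Complex.re_ofReal_mul, Complex.exp_ofReal_mul_I_re]
      ring
    · refine Integrable.mono' (hexp.const_mul |1 - t|) ?_ ?_
      · exact Measurable.aestronglyMeasurable (by fun_prop)
      · filter_upwards [ae_restrict_mem measurableSet_Ioi] with u hu
        rw [norm_mul, Complex.norm_exp_ofReal_mul_I, mul_one, Complex.norm_real, Real.norm_eq_abs,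
          abs_mul, abs_mul, Real.abs_exp, mul_assoc]
        gcongr
        exact hM u hu
  · refine Integrable.mono' (g := fun z => (M * Real.exp (-σ * z.1)) * 1) ?_ ?_ ?_
    · exact hexp.mul_prod (g := fun _ => (1 : ℝ)) (by simp)
    · exact Measurable.aestronglyMeasurable (by simp only [Function.uncurry_def]; fun_prop)
    · have : ∀ᵐ z : ℝ × ℝ ∂(volume.restrict (Ioi 0)).prod (volume.restrict (Ioc 0 1)),
          z ∈ Ioi (0:ℝ) ×ˢ Ioc (0:ℝ) 1 := by
        rw [Measure.prod_restrict]
        exact ae_restrict_mem (measurableSet_Ioi.prod measurableSet_Ioc)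
      filter_upwards [this] with z hz
      obtain ⟨h1, h2⟩ := hz
      simp only [Function.uncurry_def, norm_mul, Real.norm_eq_abs, Real.abs_exp]
      have hz2 : |1 - z.2| ≤ 1 := by rw [abs_le]; constructor <;> linarith [h2.1, h2.2]
      have := hM z.1 h1
      have hM0 : 0 ≤ M := (abs_nonneg _).trans this
      have h5 := Real.abs_cos_le_one (z.2 * (l * (v - z.1)))
      exact mul_le_mul (by gcongr) (mul_le_one₀ hz2 (abs_nonneg _) h5) (by positivity)
        (by positivity)

/-- The identity for damped Fejér averages, in the limit of no damping. -/
lemma integral_mul_fejer (hB : Measurable B) (hM : ∀ u, 0 < u → |B u| ≤ M)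
    (hH : ∀ s : ℂ, 0 < s.re → ∫ u in Ioi (0 : ℝ), (B u : ℂ) * Complex.exp (-s * u) = H s)
    (hc : ContinuousOn H {s | 0 ≤ s.re}) {l : ℝ} (hl : 0 < l) (v : ℝ) :
    ∫ u in Ioi (0 : ℝ), B u * fejer (l * (v - u)) =
      ∫ t in (0 : ℝ)..1, ((1 - t : ℝ) *
        (Complex.exp (Complex.I * (l * v * t : ℝ)) * H (Complex.I * (l * t : ℝ)))).re := by
  have hs : Tendsto (fun n : ℕ => 1 / ((n : ℝ) + 1)) atTop (𝓝 0) :=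
    tendsto_one_div_add_atTop_nhds_zero_nat
  have hpos : ∀ n : ℕ, 0 < 1 / ((n : ℝ) + 1) := fun n => by positivity
  have hone : ∀ n : ℕ, 1 / ((n : ℝ) + 1) ≤ 1 := fun n => by
    rw [div_le_one (by positivity)]; linarith [n.cast_nonneg (α := ℝ)]
  have hcF := continuous_fejer
  have L1 : Tendsto (fun n : ℕ => ∫ u in Ioi (0 : ℝ),
      B u * Real.exp (-(1 / ((n : ℝ) + 1)) * u) * fejer (l * (v - u))) atTop
      (𝓝 (∫ u in Ioi (0 : ℝ), B u * fejer (l * (v - u)))) := by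
    refine tendsto_integral_of_dominated_convergence (fun u => M * fejer (l * (v - u)))
      (fun n => Measurable.aestronglyMeasurable (by fun_prop))
      ((integrable_fejer_comp hl v).const_mul M).integrableOn ?_ ?_
    · intro n
      filter_upwards [ae_restrict_mem measurableSet_Ioi] with u hu
      rw [norm_mul, norm_mul, Real.norm_of_nonneg (fejer_nonneg _), Real.norm_eq_abs,
        Real.norm_eq_abs, Real.abs_exp]
      have h1 : Real.exp (-(1 / ((n : ℝ) + 1)) * u) ≤ 1 := by
        rw [Real.exp_le_one_iff]
        have := mul_pos (hpos n) hu
        linarith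
      have h2 := hM u hu
      have := fejer_nonneg (l * (v - u))
      gcongr
      exact (mul_le_of_le_one_right (abs_nonneg _) h1).trans h2
    · refine Eventually.of_forall fun u => ?_
      have : Tendsto (fun n : ℕ => B u * Real.exp (-(1 / ((n : ℝ) + 1)) * u) *
          fejer (l * (v - u))) atTop (𝓝 (B u * Real.exp (-0 * u) * fejer (l * (v - u)))) :=
        (((Real.continuous_exp.tendsto _).comp ((hs.neg).mul_const u)).const_mul (B u)).mul_const _
      simpa using this
  -- on the compact rectangle swept out by the arguments, `H` is bounded
  obtain ⟨C, hC⟩ : ∃ C, ∀ s ∈ (Icc (0 : ℝ) 1) ×ℂ (Icc 0 l), ‖H s‖ ≤ C := by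
    refine (isCompact_Icc.reProdIm isCompact_Icc).exists_bound_of_continuousOn (hc.mono ?_)
    rintro s ⟨h1, -⟩
    exact h1.1
  have hmem : ∀ x ∈ Icc (0 : ℝ) 1, ∀ t ∈ Ioc (0 : ℝ) 1,
      (x : ℂ) + Complex.I * (l * t : ℝ) ∈ (Icc (0 : ℝ) 1) ×ℂ (Icc 0 l) := by
    intro x hx t ht
    rw [Complex.mem_reProdIm]
    simp only [Complex.add_re, Complex.ofReal_re, Complex.mul_re, Complex.I_re, Complex.I_im,
      Complex.ofReal_im, Complex.add_im, Complex.mul_im]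
    refine ⟨by simpa using hx, ?_, ?_⟩
    · have := mul_pos hl ht.1
      linarith
    · nlinarith [ht.2]
  have L2 : Tendsto (fun n : ℕ => ∫ t in (0 : ℝ)..1, ((1 - t : ℝ) *
        (Complex.exp (Complex.I * (l * v * t : ℝ)) *
          H ((1 / ((n : ℝ) + 1) : ℝ) + Complex.I * (l * t : ℝ)))).re) atTop
      (𝓝 (∫ t in (0 : ℝ)..1, ((1 - t : ℝ) *
        (Complex.exp (Complex.I * (l * v * t : ℝ)) * H (Complex.I * (l * t : ℝ)))).re)) := by
    refine intervalIntegral.tendsto_integral_filter_of_dominated_convergence (fun _ => C)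
      (Eventually.of_forall fun n => ?_) (Eventually.of_forall fun n => ?_) (by simp) ?_
    · rw [uIoc_of_le zero_le_one]
      refine ContinuousOn.aestronglyMeasurable ?_ measurableSet_Ioc
      have : ContinuousOn (fun t : ℝ => H ((1 / ((n : ℝ) + 1) : ℝ) + Complex.I * (l * t : ℝ)))
          (Ioc 0 1) := by
        refine hc.comp (by fun_prop) fun t _ => ?_
        have := (hpos n).le
        simp only [mem_ofPred_eq, Complex.add_re, Complex.ofReal_re, Complex.mul_re,
          Complex.I_re, Complex.I_im, Complex.ofReal_im]
        linarith
      exact Complex.continuous_re.comp_continuousOn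
        (ContinuousOn.mul (by fun_prop) (ContinuousOn.mul (by fun_prop) this))
    · refine Eventually.of_forall fun t ht => ?_
      rw [uIoc_of_le zero_le_one] at ht
      refine (Complex.abs_re_le_norm _).trans ?_
      rw [norm_mul, norm_mul, mul_comm Complex.I ((l * v * t : ℝ) : ℂ),
        Complex.norm_exp_ofReal_mul_I, one_mul, Complex.norm_real, Real.norm_eq_abs]
      have h1 := hC _ (hmem _ ⟨(hpos n).le, hone n⟩ t ht)
      have h2 : |1 - t| ≤ 1 := by rw [abs_le]; constructor <;> linarith [ht.1, ht.2]
      have h3 := (norm_nonneg _).trans h1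
      calc _ ≤ 1 * C := by gcongr
        _ = C := one_mul C
    · refine Eventually.of_forall fun t ht => ?_
      rw [uIoc_of_le zero_le_one] at ht
      refine (Complex.continuous_re.tendsto _).comp (Tendsto.const_mul _ (Tendsto.const_mul _ ?_))
      refine (hc (Complex.I * (l * t : ℝ)) (by simp)).tendsto.comp
        (tendsto_nhdsWithin_iff.2 ⟨?_, Eventually.of_forall fun n => ?_⟩)
      · have := ((Complex.continuous_ofReal.tendsto 0).comp hs).add_const
          (Complex.I * (l * t : ℝ))
        simpa using this
      · have := (hpos n).le
        simp only [mem_ofPred_eq, Complex.add_re, Complex.ofReal_re, Complex.mul_re,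
          Complex.I_re, Complex.I_im, Complex.ofReal_im]
        linarith
  refine tendsto_nhds_unique L1 (L2.congr fun n => ?_)
  exact (integral_mul_exp_mul_fejer hB hM hH v (hpos n)).symm

/-- By the Riemann–Lebesgue lemma, continuity of the Laplace transform up to the imaginary axis
makes the Fejér averages of a bounded function tend to `0`. -/
lemma tendsto_integral_mul_fejer (hB : Measurable B) (hM : ∀ u, 0 < u → |B u| ≤ M)
    (hH : ∀ s : ℂ, 0 < s.re → ∫ u in Ioi (0 : ℝ), (B u : ℂ) * Complex.exp (-s * u) = H s)
    (hc : ContinuousOn H {s | 0 ≤ s.re}) {l : ℝ} (hl : 0 < l) :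
    Tendsto (fun v => ∫ u in Ioi (0 : ℝ), B u * fejer (l * (v - u))) atTop (𝓝 0) := by
  simp_rw [integral_mul_fejer hB hM hH hc hl]
  set g : ℝ → ℂ := (Ioc (0 : ℝ) 1).indicator
    fun t => (1 - t : ℝ) * H (Complex.I * (l * t : ℝ)) with hg
  have hRL := Real.tendsto_integral_exp_smul_cocompact g
  have hv : Tendsto (fun v : ℝ => -(l * v / (2 * Real.pi))) atTop (cocompact ℝ) := by
    refine Tendsto.mono_right ?_ atBot_le_cocompact
    refine tendsto_neg_atTop_atBot.comp ?_
    exact (tendsto_id.const_mul_atTop hl).atTop_div_const (by positivity)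
  have h0 := (Complex.continuous_re.tendsto _).comp (hRL.comp hv)
  rw [Complex.zero_re] at h0
  refine h0.congr fun v => ?_
  have hcon : ContinuousOn (fun t : ℝ => ((1 - t : ℝ) : ℂ) *
        (Complex.exp (Complex.I * (l * v * t : ℝ)) * H (Complex.I * (l * t : ℝ)))) (Icc 0 1) := by
    refine ContinuousOn.mul (by fun_prop) (ContinuousOn.mul (by fun_prop) ?_)
    exact hc.comp (by fun_prop) fun t _ => by simp
  have hint : IntegrableOn (fun t : ℝ => ((1 - t : ℝ) : ℂ) *
        (Complex.exp (Complex.I * (l * v * t : ℝ)) * H (Complex.I * (l * t : ℝ)))) (Ioc 0 1) :=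
    (hcon.integrableOn_compact isCompact_Icc).mono_set Ioc_subset_Icc_self
  rw [intervalIntegral.integral_of_le zero_le_one, ← RCLike.re_eq_complex_re, integral_re hint]
  simp only [Function.comp, RCLike.re_eq_complex_re]
  congr 1
  rw [← integral_indicator measurableSet_Ioc]
  refine integral_congr_ae (Eventually.of_forall fun t => ?_)
  simp only [hg, indicator]
  split_ifs with ht
  · rw [Circle.smul_def, Real.fourierChar_apply, smul_eq_mul]
    have : ((2 * Real.pi * -(t * -(l * v / (2 * Real.pi))) : ℝ) : ℂ) * Complex.I =
        Complex.I * (l * v * t : ℝ) := by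
      rw [mul_comm]
      congr 2
      field_simp
    rw [this]
    ring
  · simp

lemma tendsto_intervalIntegral_fejer :
    Tendsto (fun n : ℕ => ∫ w in (-(n : ℝ))..n, fejer w) atTop (𝓝 (∫ w, fejer w)) :=
  intervalIntegral_tendsto_integral integrable_fejer
    (tendsto_neg_atTop_atBot.comp tendsto_natCast_atTop_atTop) tendsto_natCast_atTop_atTop

variable {S : ℝ → ℝ}

lemma integrableOn_mul_fejer (hS : Measurable S) (hM : ∀ u, |S u| ≤ M) {l : ℝ} (hl : 0 < l)
    (v : ℝ) (s : Set ℝ) : IntegrableOn (fun u => S u * fejer (l * (v - u))) s := by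
  have hcF := continuous_fejer
  refine Integrable.integrableOn (((integrable_fejer_comp hl v).const_mul M).mono'
    (Measurable.aestronglyMeasurable (by fun_prop)) (Eventually.of_forall fun u => ?_))
  rw [norm_mul, Real.norm_of_nonneg (fejer_nonneg _)]
  exact mul_le_mul_of_nonneg_right (hM u) (fejer_nonneg _)

/-- If `e ^ u * S u` is monotone, a Fejér average of `S` around `v + δ` bounds `S v` from above. -/
lemma mul_le_integral_mul_fejer (hS : Measurable S) (h0 : ∀ u, 0 ≤ S u) (hM : ∀ u, S u ≤ M)
    (hmono : Monotone fun u => Real.exp u * S u) {l δ : ℝ} (hl : 0 < l) (hδ : 0 < δ) {v : ℝ}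
    (hv : 0 < v) :
    S v * Real.exp (-(2 * δ)) * (l⁻¹ * ∫ w in (-(l * δ))..(l * δ), fejer w) ≤
      ∫ u in Ioi (0 : ℝ), S u * fejer (l * (v + δ - u)) := by
  have hM' : ∀ u, |S u| ≤ M := fun u => by rw [abs_of_nonneg (h0 u)]; exact hM u
  rw [← integral_fejer_Icc hl (v + δ), ← intervalIntegral.integral_const_mul,
    intervalIntegral.integral_of_le (by linarith)]
  have hsub : Ioc (v + δ - δ) (v + δ + δ) ⊆ Ioi 0 := fun u hu => by
    have := hu.1
    simp only [mem_Ioi]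
    linarith
  refine le_trans (setIntegral_mono_on ((integrable_fejer_comp hl _).const_mul _).integrableOn
    (integrableOn_mul_fejer hS hM' hl _ _) measurableSet_Ioc fun u hu => ?_)
    (setIntegral_mono_set (integrableOn_mul_fejer hS hM' hl _ _)
      (Eventually.of_forall fun u => mul_nonneg (h0 u) (fejer_nonneg _)) hsub.eventuallyLE)
  refine mul_le_mul_of_nonneg_right ?_ (fejer_nonneg _)
  have h1 : v ≤ u := by linarith [hu.1]
  have h2 : u ≤ v + 2 * δ := by linarith [hu.2]
  have h3 : Real.exp v * S v ≤ Real.exp u * S u := hmono h1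
  have h4 : Real.exp u * S u ≤ Real.exp (v + 2 * δ) * S u :=
    mul_le_mul_of_nonneg_right (Real.exp_le_exp.2 h2) (h0 u)
  have h5 := Real.exp_pos v
  rw [Real.exp_add, mul_assoc] at h4
  have h6 := le_of_mul_le_mul_left (h3.trans h4) h5
  rw [Real.exp_neg, ← div_eq_mul_inv, div_le_iff₀ (Real.exp_pos _), mul_comm]
  exact h6

/-- If `e ^ u * S u` is monotone, a Fejér average of `S` around `v - δ` bounds `S v` from below,
up to the mass of the kernel outside the window. -/
lemma integral_mul_fejer_le (hS : Measurable S) (h0 : ∀ u, 0 ≤ S u) (hM : ∀ u, S u ≤ M)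
    (hmono : Monotone fun u => Real.exp u * S u) {l δ : ℝ} (hl : 0 < l) (hδ : 0 < δ) (v : ℝ) :
    ∫ u in Ioi (0 : ℝ), S u * fejer (l * (v - δ - u)) ≤
      l⁻¹ * (S v * Real.exp (2 * δ) * (∫ w, fejer w) +
        M * ((∫ w, fejer w) - ∫ w in (-(l * δ))..(l * δ), fejer w)) := by
  have hM' : ∀ u, |S u| ≤ M := fun u => by rw [abs_of_nonneg (h0 u)]; exact hM u
  have hI := integrable_fejer_comp hl (v - δ)
  set W := Ioc (v - δ - δ) (v - δ + δ) with hW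
  have hsplit : (∫ u in W, fejer (l * (v - δ - u))) + ∫ u in Wᶜ, fejer (l * (v - δ - u)) =
      ∫ u, fejer (l * (v - δ - u)) := integral_add_compl measurableSet_Ioc hI
  have hWeq : ∫ u in W, fejer (l * (v - δ - u)) =
      l⁻¹ * ∫ w in (-(l * δ))..(l * δ), fejer w := by
    rw [← integral_fejer_Icc hl (v - δ), intervalIntegral.integral_of_le (by linarith)]
  rw [integral_fejer_comp hl] at hsplit
  have hWle : ∫ u in W, fejer (l * (v - δ - u)) ≤ l⁻¹ * ∫ w, fejer w := by
    rw [← integral_fejer_comp hl (v - δ)]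
    exact setIntegral_le_integral hI (Eventually.of_forall fun u => fejer_nonneg _)
  calc ∫ u in Ioi (0 : ℝ), S u * fejer (l * (v - δ - u))
      ≤ ∫ u, S u * fejer (l * (v - δ - u)) :=
        setIntegral_le_integral (by simpa using integrableOn_mul_fejer hS hM' hl (v - δ) univ)
          (Eventually.of_forall fun u => mul_nonneg (h0 u) (fejer_nonneg _))
    _ = (∫ u in W, S u * fejer (l * (v - δ - u))) +
          ∫ u in Wᶜ, S u * fejer (l * (v - δ - u)) :=
        (integral_add_compl measurableSet_Ioc
          (by simpa using integrableOn_mul_fejer hS hM' hl (v - δ) univ)).symm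
    _ ≤ (∫ u in W, S v * Real.exp (2 * δ) * fejer (l * (v - δ - u))) +
          ∫ u in Wᶜ, M * fejer (l * (v - δ - u)) := by
        refine add_le_add (setIntegral_mono_on (integrableOn_mul_fejer hS hM' hl _ _)
          (hI.const_mul _).integrableOn measurableSet_Ioc fun u hu => ?_)
          (setIntegral_mono_on (integrableOn_mul_fejer hS hM' hl _ _)
          (hI.const_mul _).integrableOn measurableSet_Ioc.compl fun u hu =>
            mul_le_mul_of_nonneg_right (hM u) (fejer_nonneg _))
        refine mul_le_mul_of_nonneg_right ?_ (fejer_nonneg _)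
        have h1 : u ≤ v := by linarith [hu.2]
        have h2 : v ≤ u + 2 * δ := by linarith [hu.1]
        have h3 : Real.exp u * S u ≤ Real.exp v * S v := hmono h1
        have h4 : Real.exp v * S v ≤ Real.exp (u + 2 * δ) * S v :=
          mul_le_mul_of_nonneg_right (Real.exp_le_exp.2 h2) (h0 v)
        rw [Real.exp_add, mul_assoc] at h4
        rw [mul_comm (S v)]
        exact le_of_mul_le_mul_left (h3.trans h4) (Real.exp_pos u)
    _ = S v * Real.exp (2 * δ) * (∫ u in W, fejer (l * (v - δ - u))) +
          M * ∫ u in Wᶜ, fejer (l * (v - δ - u)) := by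
        rw [integral_const_mul, integral_const_mul]
    _ ≤ S v * Real.exp (2 * δ) * (l⁻¹ * ∫ w, fejer w) +
          M * (l⁻¹ * (∫ w, fejer w) - l⁻¹ * ∫ w in (-(l * δ))..(l * δ), fejer w) := by
        rw [← hWeq, ← eq_sub_iff_add_eq'.2 hsplit]
        have := h0 v
        gcongr
    _ = _ := by ring

lemma tendsto_integral_bounded_mul_fejer {A : ℝ} (hS : Measurable S) (h0 : ∀ u, 0 ≤ S u)
    (hM : ∀ u, S u ≤ M)
    (hH : ∀ s : ℂ, 0 < s.re →
      ∫ u in Ioi (0 : ℝ), ((S u - A : ℝ) : ℂ) * Complex.exp (-s * u) = H s)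
    (hc : ContinuousOn H {s | 0 ≤ s.re}) {l : ℝ} (hl : 0 < l) :
    Tendsto (fun v => ∫ u in Ioi (0 : ℝ), S u * fejer (l * (v - u))) atTop
      (𝓝 (A * (l⁻¹ * ∫ w, fejer w))) := by
  have hM' : ∀ u, |S u| ≤ M := fun u => by rw [abs_of_nonneg (h0 u)]; exact hM u
  have h1 := tendsto_integral_mul_fejer (B := fun u => S u - A) (M := M + |A|) (by fun_prop)
    (fun u _ => (abs_sub _ _).trans (by gcongr; exact hM' u)) hH hc hl
  have h2 := h1.add ((tendsto_integral_fejer_Ioi hl).const_mul A)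
  rw [zero_add] at h2
  refine h2.congr fun v => ?_
  rw [← integral_const_mul, ← integral_add]
  · simp only [sub_mul, sub_add_cancel]
  · simp only [sub_mul]
    exact (integrableOn_mul_fejer hS hM' hl v _).sub
      ((integrable_fejer_comp hl v).const_mul A).integrableOn
  · exact ((integrable_fejer_comp hl v).const_mul A).integrableOn

/-- A Tauberian theorem of Wiener–Ikehara type: if `S` is bounded, `e ^ u * S u` is monotone and the
Laplace transform of `S - A` extends continuously to the imaginary axis, then `S` tends to `A`. -/
theorem tendsto_of_continuousOn_laplace {A : ℝ} (hS : Measurable S) (h0 : ∀ u, 0 ≤ S u)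
    (hM : ∀ u, S u ≤ M) (hmono : Monotone fun u => Real.exp u * S u)
    (hH : ∀ s : ℂ, 0 < s.re →
      ∫ u in Ioi (0 : ℝ), ((S u - A : ℝ) : ℂ) * Complex.exp (-s * u) = H s)
    (hc : ContinuousOn H {s | 0 ≤ s.re}) : Tendsto S atTop (𝓝 A) := by
  set c := ∫ w, fejer w with hcdef
  have hcpos : 0 < c := integral_fejer_pos
  have hcn := tendsto_intervalIntegral_fejer
  rw [← hcdef] at hcn
  have hinv : Tendsto (fun n : ℕ => 1 / (n : ℝ)) atTop (𝓝 0) := tendsto_one_div_atTop_nhds_zero_nat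
  have hexp : ∀ a : ℝ, Tendsto (fun n : ℕ => Real.exp (a * (1 / (n : ℝ)))) atTop (𝓝 1) := by
    intro a
    have := (Real.continuous_exp.tendsto _).comp (hinv.const_mul a)
    simpa [Function.comp_def] using this
  -- the window has half-width `δ = 1 / n` and the kernel scale is `l = n ^ 2`, so that `l * δ = n`
  refine tendsto_order.2 ⟨fun A' hA' => ?_, fun A' hA' => ?_⟩
  · have hlim : Tendsto (fun n : ℕ => Real.exp (-2 * (1 / (n : ℝ))) *
        ((A * c - 1 / (n : ℝ)) - M * (c - ∫ w in (-(n : ℝ))..n, fejer w)) / c) atTop (𝓝 A) := by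
      have := ((hexp (-2)).mul
        ((hinv.const_sub (A * c)).sub ((hcn.const_sub c).const_mul M))).div_const c
      simpa [hcpos.ne'] using this
    obtain ⟨n, hn, hn1⟩ := ((hlim.eventually_const_lt hA').and (eventually_ge_atTop 1)).exists
    have hnp : (0 : ℝ) < n := by exact_mod_cast hn1
    have hl : (0 : ℝ) < (n : ℝ) ^ 2 := by positivity
    have hT := (tendsto_integral_bounded_mul_fejer hS h0 hM hH hc hl).comp
      (tendsto_atTop_add_const_right atTop (-(1 / (n : ℝ))) tendsto_id)
    have hlt : (((n : ℝ) ^ 2)⁻¹ * (A * c - 1 / (n : ℝ))) < A * (((n : ℝ) ^ 2)⁻¹ * c) := by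
      have : 0 < ((n : ℝ) ^ 2)⁻¹ * (1 / (n : ℝ)) := by positivity
      nlinarith
    filter_upwards [hT.eventually_const_lt hlt] with v hv
    refine hn.trans_le ?_
    have h1 := integral_mul_fejer_le hS h0 hM hmono hl (one_div_pos.2 hnp) v
    have hln : (n : ℝ) ^ 2 * (1 / (n : ℝ)) = n := by field_simp
    rw [hln] at h1
    have h2 := lt_of_mul_lt_mul_left (hv.trans_le h1) (by positivity)
    rw [div_le_iff₀ hcpos, neg_mul, Real.exp_neg, inv_mul_le_iff₀ (Real.exp_pos _)]
    linarith
  · have hlim : Tendsto (fun n : ℕ => (A * c + 1 / (n : ℝ)) * Real.exp (2 * (1 / (n : ℝ))) /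
        ∫ w in (-(n : ℝ))..n, fejer w) atTop (𝓝 A) := by
      have := ((hinv.const_add (A * c)).mul (hexp 2)).div hcn hcpos.ne'
      simpa [hcpos.ne', Pi.div_def] using this
    obtain ⟨n, ⟨hn, hn1⟩, hn2⟩ := (((hlim.eventually_lt_const hA').and
      (eventually_ge_atTop 1)).and (hcn.eventually_const_lt hcpos)).exists
    have hnp : (0 : ℝ) < n := by exact_mod_cast hn1
    have hl : (0 : ℝ) < (n : ℝ) ^ 2 := by positivity
    have hT := (tendsto_integral_bounded_mul_fejer hS h0 hM hH hc hl).comp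
      (tendsto_atTop_add_const_right atTop (1 / (n : ℝ)) tendsto_id)
    have hlt : A * (((n : ℝ) ^ 2)⁻¹ * c) < (((n : ℝ) ^ 2)⁻¹ * (A * c + 1 / (n : ℝ))) := by
      have : 0 < ((n : ℝ) ^ 2)⁻¹ * (1 / (n : ℝ)) := by positivity
      nlinarith
    filter_upwards [hT.eventually_lt_const hlt, eventually_gt_atTop 0] with v hv hv0
    refine lt_of_le_of_lt ?_ hn
    have h1 := mul_le_integral_mul_fejer hS h0 hM hmono hl (one_div_pos.2 hnp) hv0
    have hln : (n : ℝ) ^ 2 * (1 / (n : ℝ)) = n := by field_simp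
    rw [hln, mul_left_comm] at h1
    have h2 := lt_of_mul_lt_mul_left (h1.trans_lt hv) (by positivity)
    rw [le_div_iff₀ hn2]
    rw [Real.exp_neg, mul_right_comm, ← div_eq_mul_inv, div_lt_iff₀ (Real.exp_pos _)] at h2
    exact h2.le

end Tauberian

/-! ### The Wiener–Ikehara theorem and primes in progressions -/

section WienerIkehara

open MeasureTheory Set

lemma integral_Ioi_one_eq (g : ℝ → ℂ) :
    ∫ t in Ioi (1 : ℝ), g t = ∫ u in Ioi (0 : ℝ), (Real.exp u : ℂ) * g (Real.exp u) := by
  have himg : Real.exp '' Ioi 0 = Ioi 1 := by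
    ext t
    simp only [mem_image, mem_Ioi]
    constructor
    · rintro ⟨u, hu, rfl⟩
      exact Real.one_lt_exp_iff.2 hu
    · intro ht
      exact ⟨Real.log t, Real.log_pos ht, Real.exp_log (by linarith)⟩
  rw [← himg, integral_image_eq_integral_abs_deriv_smul measurableSet_Ioi
    (fun u _ => (Real.hasDerivAt_exp u).hasDerivWithinAt) Real.exp_injective.injOn]
  simp [Real.abs_exp]

/-- The Wiener–Ikehara theorem, with a linear bound on the partial sums as a hypothesis. -/
theorem tendsto_sum_div_of_continuousOn_LSeries_sub {f : ℕ → ℝ} (hf : ∀ n, 0 ≤ f n) {C A : ℝ}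
    (hC : ∀ n : ℕ, ∑ k ∈ Finset.Icc 1 n, f k ≤ C * n) {G : ℂ → ℂ}
    (hG : ContinuousOn G {s | 1 ≤ s.re})
    (hL : ∀ s : ℂ, 1 < s.re → LSeries (fun n => f n) s = A / (s - 1) + G s) :
    Tendsto (fun n : ℕ => (∑ k ∈ Finset.Icc 1 n, f k) / (n : ℝ)) atTop (𝓝 A) := by
  set P : ℝ → ℝ := fun x => ∑ k ∈ Finset.Icc 1 ⌊x⌋₊, f k with hP
  have hPmono : Monotone P := fun x y hxy => by
    refine Finset.sum_le_sum_of_subset_of_nonneg ?_ fun i _ _ => hf i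
    exact Finset.Icc_subset_Icc_right (Nat.floor_mono hxy)
  have hP0 : ∀ x, 0 ≤ P x := fun x => Finset.sum_nonneg fun i _ => hf i
  have hC0 : 0 ≤ C := by
    have := hC 1
    have h1 := hf 1
    simp at this
    linarith
  have hPle : ∀ x, 0 ≤ x → P x ≤ C * x := fun x hx =>
    (hC _).trans (by gcongr; exact Nat.floor_le hx)
  set S : ℝ → ℝ := fun u => P (Real.exp u) * Real.exp (-u) with hSdef
  have hSm : Measurable S := (hPmono.measurable.comp Real.measurable_exp).mul (by fun_prop)
  have hS0 : ∀ u, 0 ≤ S u := fun u => mul_nonneg (hP0 _) (Real.exp_pos _).le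
  have hSC : ∀ u, S u ≤ C := fun u => by
    have := hPle _ (Real.exp_pos u).le
    rw [hSdef]
    simp only
    rw [Real.exp_neg, ← div_eq_mul_inv, div_le_iff₀ (Real.exp_pos u)]
    exact this
  have hmono : Monotone fun u => Real.exp u * S u := by
    have : (fun u => Real.exp u * S u) = fun u => P (Real.exp u) := by
      ext u
      simp only [hSdef]
      rw [mul_left_comm, ← Real.exp_add]
      simp
    rw [this]
    exact hPmono.comp Real.exp_monotone
  have hbigO : (fun n : ℕ => ∑ k ∈ Finset.Icc 1 n, f k) =O[atTop]
      fun n : ℕ => (n : ℝ) ^ (1 : ℝ) := by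
    refine Asymptotics.IsBigO.of_bound C (Eventually.of_forall fun n => ?_)
    rw [Real.norm_of_nonneg (Finset.sum_nonneg fun i _ => hf i), Real.rpow_one,
      Real.norm_of_nonneg (Nat.cast_nonneg n)]
    exact hC n
  have hH : ∀ s : ℂ, 0 < s.re →
      ∫ u in Ioi (0 : ℝ), ((S u - A : ℝ) : ℂ) * Complex.exp (-s * u) =
        (G (1 + s) - A) / (1 + s) := by
    intro s hs
    have hs1 : 1 < (1 + s).re := by simpa using hs
    have hs0 : s ≠ 0 := by rintro rfl; simp at hs
    have hs10 : 1 + s ≠ 0 := by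
      intro h; rw [h] at hs1; simp at hs1; linarith
    have h1 := LSeries_eq_mul_integral_of_nonneg f zero_le_one hs1 hbigO hf
    rw [hL _ hs1, integral_Ioi_one_eq] at h1
    have h2 : ∀ u : ℝ, (Real.exp u : ℂ) * ((∑ k ∈ Finset.Icc 1 ⌊Real.exp u⌋₊, (f k : ℂ)) *
        (Real.exp u : ℂ) ^ (-(1 + s + 1))) = (S u : ℂ) * Complex.exp (-s * u) := by
      intro u
      rw [Complex.cpow_def_of_ne_zero (by exact_mod_cast (Real.exp_pos u).ne'),
        ← Complex.ofReal_log (Real.exp_pos u).le, Real.log_exp]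
      simp only [hSdef, hP]
      push_cast
      have : Complex.exp u * Complex.exp (u * (-(1 + s + 1))) =
          Complex.exp (-u) * Complex.exp (-s * u) := by
        rw [← Complex.exp_add, ← Complex.exp_add]
        congr 1
        ring
      linear_combination (∑ k ∈ Finset.Icc 1 ⌊Real.exp u⌋₊, (f k : ℂ)) * this
    simp_rw [h2] at h1
    have hexpint : IntegrableOn (fun u : ℝ => Complex.exp (-s * u)) (Ioi 0) :=
      integrableOn_exp_mul_complex_Ioi (by simpa using hs) 0
    have hint : IntegrableOn (fun u : ℝ => (S u : ℂ) * Complex.exp (-s * u)) (Ioi 0) := by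
      refine Integrable.bdd_mul (c := C) hexpint (Measurable.aestronglyMeasurable (by fun_prop))
        (Eventually.of_forall fun u => ?_)
      rw [Complex.norm_real, Real.norm_of_nonneg (hS0 u)]
      exact hSC u
    have h3 : ∫ u in Ioi (0 : ℝ), Complex.exp (-s * u) = 1 / s := by
      rw [integral_exp_mul_complex_Ioi (by simpa using hs)]
      simp
    push_cast
    simp_rw [sub_mul]
    rw [integral_sub hint (hexpint.const_mul _), integral_const_mul, h3]
    rw [add_sub_cancel_left] at h1
    rw [eq_div_iff hs10, sub_mul, mul_comm _ (1 + s), ← h1]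
    field_simp
    ring
  have hc : ContinuousOn (fun s : ℂ => (G (1 + s) - A) / (1 + s)) {s | 0 ≤ s.re} := by
    refine ContinuousOn.div ((hG.comp (by fun_prop) fun s hs => ?_).sub continuousOn_const)
      (by fun_prop) fun s hs h => ?_
    · simpa using hs
    · have : (1 + s).re = 0 := by rw [h]; simp
      have hs' : 0 ≤ s.re := hs
      simp at this
      linarith
  have hlim := tendsto_of_continuousOn_laplace hSm hS0 hSC hmono hH hc
  have := hlim.comp (Real.tendsto_log_atTop.comp tendsto_natCast_atTop_atTop)
  refine this.congr' ?_
  filter_upwards [eventually_gt_atTop 0] with n hn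
  have hn' : (0 : ℝ) < n := by exact_mod_cast hn
  simp only [Function.comp, hSdef, hP, Real.exp_log hn', Real.exp_neg, Nat.floor_natCast,
    div_eq_mul_inv]

open ArithmeticFunction.vonMangoldt in
/-- The prime number theorem in arithmetic progressions, for Chebyshev's `ψ`. -/
theorem tendsto_sum_residueClass_div {q : ℕ} [NeZero q] {a : ZMod q} (ha : IsUnit a) :
    Tendsto (fun n : ℕ => (∑ k ∈ Finset.Icc 1 n, residueClass a k) / (n : ℝ)) atTop
      (𝓝 (q.totient : ℝ)⁻¹) := by
  refine tendsto_sum_div_of_continuousOn_LSeries_sub (residueClass_nonneg a)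
    (C := Real.log 4 + 4) (fun n => ?_) (continuousOn_LFunctionResidueClassAux a) fun s hs => ?_
  · refine le_trans (Finset.sum_le_sum fun k _ => residueClass_le a k) ?_
    have := Chebyshev.psi_le_const_mul_self (Nat.cast_nonneg (α := ℝ) n)
    rwa [Chebyshev.psi, Nat.floor_natCast] at this
  · rw [eqOn_LFunctionResidueClassAux ha hs]
    push_cast
    ring

end WienerIkehara

/-! ### The density of primes `1` modulo `q` -/

section Density

open Asymptotics

lemma primesUpTo_eq_primesLE (n : ℕ) : primesUpTo n = Nat.primesLE n := by
  ext p
  simp only [primesUpTo, Finset.mem_filter, Finset.mem_Icc, Nat.mem_primesLE]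
  exact ⟨fun h => ⟨h.1.2, h.2⟩, fun h => ⟨⟨h.2.one_le, h.1⟩, h.2⟩⟩

lemma card_primesUpTo (n : ℕ) : (primesUpTo n).card = Nat.primeCounting n := by
  rw [primesUpTo_eq_primesLE]
  simp

lemma prime_of_mem_primesUpTo {n r : ℕ} (h : r ∈ primesUpTo n) : r.Prime :=
  (Finset.mem_filter.1 h).2

lemma le_of_mem_primesUpTo {n r : ℕ} (h : r ∈ primesUpTo n) : r ≤ n :=
  (Finset.mem_Icc.1 (Finset.mem_filter.1 h).1).2

/-- The number of primes `r ≤ n` with `r ≡ 1 [MOD q]`. -/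
def primesOneModCount (q n : ℕ) : ℕ := ((primesUpTo n).filter fun r => q ∣ r - 1).card

lemma primesOneModCount_one (n : ℕ) : primesOneModCount 1 n = Nat.primeCounting n := by
  simp [primesOneModCount, card_primesUpTo]

lemma tendsto_psi_sub_theta_div :
    Tendsto (fun n : ℕ => (Chebyshev.psi n - Chebyshev.theta n) / (n : ℝ)) atTop (𝓝 0) := by
  have h1 : (Chebyshev.psi - Chebyshev.theta) =o[atTop] (fun x : ℝ => x) := by
    refine Chebyshev.isBigO_psi_sub_theta_sqrt.trans_isLittleO ?_
    refine isLittleO_of_tendsto (fun x hx => by simp [hx]) ?_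
    simp_rw [Real.sqrt_div_self]
    exact tendsto_inv_atTop_zero.comp Real.tendsto_sqrt_atTop
  exact h1.tendsto_div_nhds_zero.comp tendsto_natCast_atTop_atTop

lemma tendsto_primeCounting_mul_log_sub_theta_div :
    Tendsto (fun n : ℕ => ((Nat.primeCounting n : ℝ) * Real.log n - Chebyshev.theta n) / (n : ℝ))
      atTop (𝓝 0) := by
  have h1 : (fun x : ℝ => x / Real.log x ^ 2) =o[atTop] (fun x : ℝ => x / Real.log x) := by
    have hne : ∀ᶠ x : ℝ in atTop, x / Real.log x = 0 → x / Real.log x ^ 2 = 0 := by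
      filter_upwards [eventually_gt_atTop 1] with x hx h0
      have := Real.log_pos hx
      rcases div_eq_zero_iff.1 h0 with h0 | h0 <;> linarith
    refine isLittleO_of_tendsto' hne ?_
    refine Real.tendsto_log_atTop.inv_tendsto_atTop.congr' ?_
    filter_upwards [eventually_gt_atTop 1] with x hx
    have := Real.log_pos hx
    simp only [Pi.inv_apply]
    field_simp
  have h2 := (Chebyshev.primeCounting_sub_theta_div_log_isBigO.trans_isLittleO h1
    ).tendsto_div_nhds_zero.comp tendsto_natCast_atTop_atTop
  refine h2.congr' ?_
  filter_upwards [eventually_gt_atTop 1] with n hn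
  have hn' : (1 : ℝ) < n := by exact_mod_cast hn
  have := Real.log_pos hn'
  simp only [Function.comp, Nat.floor_natCast]
  field_simp

open ArithmeticFunction ArithmeticFunction.vonMangoldt in
/-- The prime number theorem in the progression `1` modulo `q`. -/
theorem tendsto_primesOneModCount_mul_log_div {q : ℕ} (hq : q ≠ 0) :
    Tendsto (fun n : ℕ => (primesOneModCount q n : ℝ) * Real.log n / (n : ℝ)) atTop
      (𝓝 (q.totient : ℝ)⁻¹) := by
  have : NeZero q := ⟨hq⟩
  have hψ := tendsto_sum_residueClass_div (q := q) (a := 1) isUnit_one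
  have hE := tendsto_primeCounting_mul_log_sub_theta_div
  have hE' := tendsto_psi_sub_theta_div
  set θq : ℕ → ℝ := fun n => ∑ r ∈ (primesUpTo n).filter (fun r => q ∣ r - 1), Real.log r
  have hmod : ∀ {r : ℕ}, r.Prime → ((r : ZMod q) = 1 ↔ q ∣ r - 1) := fun {r} hr => by
    rw [← Nat.cast_one, ZMod.natCast_eq_natCast_iff, Nat.ModEq.comm,
      Nat.modEq_iff_dvd' hr.one_le]
  -- the prime powers contribute the difference between `ψ` and `θ` in the progression
  have h1 : ∀ n : ℕ, (∑ k ∈ Finset.Icc 1 n, residueClass (1 : ZMod q) k) - θq n =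
      ∑ k ∈ (Finset.Icc 1 n).filter (fun k => ¬ k.Prime), residueClass (1 : ZMod q) k := by
    intro n
    rw [← Finset.sum_filter_add_sum_filter_not (Finset.Icc 1 n) Nat.Prime, add_sub_right_comm]
    refine add_eq_right.2 (sub_eq_zero.2 ?_)
    simp only [θq, Finset.sum_filter (fun r => q ∣ r - 1)]
    refine Finset.sum_congr rfl fun r hr => ?_
    have hr' := prime_of_mem_primesUpTo hr
    simp only [residueClass, Set.indicator, Set.mem_ofPred_eq, hmod hr',
      vonMangoldt_apply_prime hr']
  have h2 : ∀ n : ℕ, 0 ≤ (∑ k ∈ Finset.Icc 1 n, residueClass (1 : ZMod q) k) - θq n := fun n => by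
    rw [h1]
    exact Finset.sum_nonneg fun k _ => residueClass_nonneg _ k
  have h3 : ∀ n : ℕ, (∑ k ∈ Finset.Icc 1 n, residueClass (1 : ZMod q) k) - θq n ≤
      Chebyshev.psi n - Chebyshev.theta n := fun n => by
    rw [h1, Chebyshev.psi_sub_theta_eq_sum_not_prime, Nat.floor_natCast]
    exact Finset.sum_le_sum fun k _ => residueClass_le _ k
  have hlog : ∀ n : ℕ, ∀ r ∈ primesUpTo n, 0 ≤ Real.log n - Real.log r := fun n r hr => by
    have hr' := (prime_of_mem_primesUpTo hr).pos
    rw [sub_nonneg]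
    exact Real.log_le_log (by exact_mod_cast hr') (by exact_mod_cast le_of_mem_primesUpTo hr)
  have h4 : ∀ n : ℕ, (primesOneModCount q n : ℝ) * Real.log n - θq n =
      ∑ r ∈ (primesUpTo n).filter (fun r => q ∣ r - 1), (Real.log n - Real.log r) := fun n => by
    rw [Finset.sum_sub_distrib, Finset.sum_const, nsmul_eq_mul, primesOneModCount]
  have h5 : ∀ n : ℕ, 0 ≤ (primesOneModCount q n : ℝ) * Real.log n - θq n := fun n => by
    rw [h4]
    exact Finset.sum_nonneg fun r hr => hlog n r (Finset.mem_filter.1 hr).1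
  have h6 : ∀ n : ℕ, (primesOneModCount q n : ℝ) * Real.log n - θq n ≤
      (Nat.primeCounting n : ℝ) * Real.log n - Chebyshev.theta n := fun n => by
    rw [h4, Chebyshev.theta_eq_sum_primesLE_log, ← primesUpTo_eq_primesLE, ← card_primesUpTo,
      ← nsmul_eq_mul, ← Finset.sum_const, ← Finset.sum_sub_distrib]
    exact Finset.sum_le_sum_of_subset_of_nonneg (Finset.filter_subset _ _)
      fun r hr _ => hlog n r hr
  have hd : Tendsto (fun n : ℕ => ((primesOneModCount q n : ℝ) * Real.log n / (n : ℝ)) -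
      (∑ k ∈ Finset.Icc 1 n, residueClass (1 : ZMod q) k) / (n : ℝ)) atTop (𝓝 0) := by
    refine tendsto_of_tendsto_of_tendsto_of_le_of_le (by simpa using hE'.neg) hE
      (fun n => ?_) fun n => ?_
    · simp only
      rw [← sub_div, ← neg_div]
      refine div_le_div_of_nonneg_right ?_ (Nat.cast_nonneg n)
      linarith [h3 n, h5 n]
    · simp only
      rw [← sub_div]
      refine div_le_div_of_nonneg_right ?_ (Nat.cast_nonneg n)
      linarith [h2 n, h6 n]
  simpa using hd.add hψ

lemma tendsto_primeCounting_mul_log_div :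
    Tendsto (fun n : ℕ => (Nat.primeCounting n : ℝ) * Real.log n / (n : ℝ)) atTop (𝓝 1) := by
  simpa [primesOneModCount_one] using tendsto_primesOneModCount_mul_log_div one_ne_zero

/-- The primes `r ≡ 1 [MOD q]` have density `1 / φ(q)` among all primes. -/
theorem tendsto_primesOneModCount_div {q : ℕ} (hq : q ≠ 0) :
    Tendsto (fun n : ℕ => (primesOneModCount q n : ℝ) / (Nat.primeCounting n : ℝ)) atTop
      (𝓝 (q.totient : ℝ)⁻¹) := by
  have := (tendsto_primesOneModCount_mul_log_div hq).div tendsto_primeCounting_mul_log_div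
    one_ne_zero
  rw [div_one] at this
  refine this.congr' ?_
  filter_upwards [eventually_gt_atTop 1] with n hn
  have hn' : (1 : ℝ) < n := by exact_mod_cast hn
  have := Real.log_pos hn'
  simp only [Pi.div_apply]
  field_simp

end Density

/-! ### A uniform bound for primes `1` modulo `q` -/

open Nat in
lemma dvd_prod_mul_add_one_of_coprime {q m n : ℕ} (hm : m ≠ 0) (hqm : Nat.Coprime q m)
    (hmn : m ∣ n !) : m ∣ ∏ k ∈ Finset.range n, (q * (k + 1) + 1) := by
  have : NeZero m := ⟨hm⟩
  rw [← ZMod.natCast_eq_zero_iff] at hmn ⊢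
  -- if `u` inverts `q` modulo `m`, the product is `q ^ n * ∏ (k + 1 + u)`
  set u := ((q : ZMod m)⁻¹).val
  have hu : (q : ZMod m) * u = 1 := by
    rw [ZMod.natCast_zmod_val]
    exact ZMod.coe_mul_inv_eq_one q hqm
  obtain ⟨c, hc⟩ := Nat.factorial_dvd_ascFactorial (u + 1) n
  have h1 : ((∏ k ∈ Finset.range n, (q * (k + 1) + 1) : ℕ) : ZMod m) =
      q ^ n * (((u + 1).ascFactorial n : ℕ) : ZMod m) := by
    rw [Nat.ascFactorial_eq_prod_range]
    push_cast
    rw [show (q : ZMod m) ^ n = q ^ (Finset.range n).card by simp, Finset.pow_card_mul_prod]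
    refine Finset.prod_congr rfl fun k _ => ?_
    linear_combination -hu
  rw [h1, hc]
  push_cast
  rw [hmn]
  ring

open Nat in
/-- A Chebyshev-type bound: the primes `r > n` dividing `∏ (q k + 1)`, together with the part of
`n !` prime to `q`, divide that product. -/
lemma prod_primes_one_mod_le {q : ℕ} (hq : q.Prime) {n : ℕ} {s : Finset ℕ}
    (hs : ∀ r ∈ s, r.Prime ∧ q ∣ r - 1 ∧ n < r ∧ r ≤ q * n + q) :
    ∏ r ∈ s, r ≤ (n + 1) * q ^ (2 * n) := by
  set Q := ∏ k ∈ Finset.range n, (q * (k + 1) + 1) with hQ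
  set m := ordCompl[q] (n !) with hm
  have hm0 : m ≠ 0 := (Nat.ordCompl_pos q (factorial_ne_zero n)).ne'
  have hmn : m ∣ n ! := Nat.ordCompl_dvd _ _
  have hmQ : m ∣ Q := dvd_prod_mul_add_one_of_coprime hm0
    (Nat.coprime_ordCompl hq (factorial_ne_zero n)) hmn
  have hsQ : ∏ r ∈ s, r ∣ Q := by
    refine Finset.prod_primes_dvd Q (fun r hr => (hs r hr).1.prime) fun r hr => ?_
    obtain ⟨hrp, ⟨k, hk⟩, hnr, hrn⟩ := hs r hr
    have hr1 := hrp.two_le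
    have hk0 : k ≠ 0 := by rintro rfl; omega
    have hkn : k < n + 1 := by
      by_contra h
      have : q * (n + 1) ≤ q * k := by gcongr; omega
      rw [mul_add] at this
      omega
    have : r = q * (k - 1 + 1) + 1 := by
      rw [Nat.sub_add_cancel (by omega), ← hk]
      omega
    rw [this]
    exact Finset.dvd_prod_of_mem (fun k => q * (k + 1) + 1) (Finset.mem_range.2 (by omega))
  have hcop : Nat.Coprime m (∏ r ∈ s, r) := by
    refine Nat.Coprime.prod_right fun r hr => Nat.Coprime.symm ?_
    obtain ⟨hrp, -, hnr, -⟩ := hs r hr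
    refine (Nat.Prime.coprime_iff_not_dvd hrp).2 fun h => ?_
    have := (hrp.dvd_factorial).1 (h.trans hmn)
    omega
  have hQ0 : 0 < Q := Finset.prod_pos fun k _ => by positivity
  have h1 : m * ∏ r ∈ s, r ≤ Q := Nat.le_of_dvd hQ0 (hcop.mul_dvd_of_dvd_of_dvd hmQ hsQ)
  have h2 : Q ≤ q ^ n * (n + 1) ! := by
    rw [hQ, ← Finset.prod_range_add_one_eq_factorial, Finset.prod_range_succ']
    simp only [zero_add, mul_one]
    conv_rhs => rw [← Finset.card_range n, ← Finset.prod_const]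
    simp only [Finset.card_range]
    rw [← Finset.prod_mul_distrib]
    refine Finset.prod_le_prod' fun k _ => ?_
    have := hq.one_le
    nlinarith
  have h3 : n ! ≤ q ^ n * m := by
    conv_lhs => rw [← Nat.ordProj_mul_ordCompl_eq_self (n !) q]
    refine Nat.mul_le_mul_right _ (Nat.pow_le_pow_right hq.pos ?_)
    exact (Nat.factorization_factorial_le_div_pred hq n).trans (Nat.div_le_self _ _)
  refine Nat.le_of_mul_le_mul_left ?_ (Nat.pos_of_ne_zero hm0)
  calc m * ∏ r ∈ s, r ≤ q ^ n * (n + 1) ! := h1.trans h2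
    _ = q ^ n * ((n + 1) * n !) := by rw [Nat.factorial_succ]
    _ ≤ q ^ n * ((n + 1) * (q ^ n * m)) := by gcongr
    _ = m * ((n + 1) * q ^ (2 * n)) := by ring

lemma exists_primeCounting_mul_log_le :
    ∃ C : ℝ, 0 ≤ C ∧ ∀ n : ℕ, (Nat.primeCounting n : ℝ) * Real.log n ≤ C * n := by
  obtain ⟨C, hC⟩ := (Metric.isBounded_range_of_tendsto _
    tendsto_primeCounting_mul_log_div).exists_norm_le
  have h := fun n : ℕ => (le_abs_self _).trans (hC _ (Set.mem_range_self n))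
  refine ⟨C, (norm_nonneg _).trans (hC _ (Set.mem_range_self 0)), fun n => ?_⟩
  rcases n.eq_zero_or_pos with rfl | hn
  · simp
  · have hn' : (0 : ℝ) < n := by exact_mod_cast hn
    have := h n
    rwa [div_le_iff₀ hn'] at this

lemma primesOneModCount_le_div (q n : ℕ) : primesOneModCount q n ≤ n / q := by
  rw [primesOneModCount, ← Nat.Ioc_filter_dvd_card_eq_div n q]
  refine Finset.card_le_card_of_injOn (fun r => r - 1) (fun r hr => ?_) fun r hr s hs h => ?_
  · simp only [Finset.coe_filter, Set.mem_ofPred_eq] at hr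
    have h1 := (prime_of_mem_primesUpTo hr.1).two_le
    have h2 := le_of_mem_primesUpTo hr.1
    simp only [Finset.coe_filter, Set.mem_ofPred_eq, Finset.mem_Ioc]
    exact ⟨by omega, hr.2⟩
  · simp only [Finset.coe_filter, Set.mem_ofPred_eq] at hr hs
    have h1 := (prime_of_mem_primesUpTo hr.1).two_le
    have h2 := (prime_of_mem_primesUpTo hs.1).two_le
    simp only at h
    omega

/-- For `n = ⌊N / q⌋`, primes `r ≡ 1 [MOD q]` up to `N` are counted trivially below `n` and by
the Chebyshev-type product bound above `n`. -/
lemma primesOneModCount_mul_log_le {C : ℝ}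
    (hC : ∀ n : ℕ, (Nat.primeCounting n : ℝ) * Real.log n ≤ C * n) {q : ℕ} (hq : q.Prime)
    (N : ℕ) :
    (primesOneModCount q N : ℝ) * Real.log (N / q : ℕ) ≤
      (C + 1 + 2 * Real.log q) * (N / q : ℕ) := by
  set n := N / q with hn
  set s := ((primesUpTo N).filter fun r => q ∣ r - 1).filter fun r => n < r with hs
  have hcard : primesOneModCount q N ≤ Nat.primeCounting n + s.card := by
    rw [primesOneModCount, ← Finset.card_filter_add_card_filter_not (fun r => n < r), add_comm,
      ← card_primesUpTo]
    gcongr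
    intro r hr
    simp only [primesUpTo, Finset.mem_filter, Finset.mem_Icc] at hr ⊢
    exact ⟨⟨hr.1.1.1.1, by omega⟩, hr.1.1.2⟩
  have hN : N ≤ q * n + q := by
    have h1 := Nat.div_add_mod N q
    rw [← hn] at h1
    have := Nat.mod_lt N hq.pos
    omega
  have hprod : ∏ r ∈ s, r ≤ (n + 1) * q ^ (2 * n) := by
    refine prod_primes_one_mod_le hq fun r hr => ?_
    simp only [hs, Finset.mem_filter] at hr
    exact ⟨prime_of_mem_primesUpTo hr.1.1, hr.1.2, hr.2,
      (le_of_mem_primesUpTo hr.1.1).trans hN⟩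
  have hpow : n ^ s.card ≤ (n + 1) * q ^ (2 * n) := by
    refine le_trans ?_ hprod
    exact Finset.pow_card_le_prod _ _ _ fun r hr => (Finset.mem_filter.1 hr).2.le
  have hlogn : 0 ≤ Real.log n := Real.log_natCast_nonneg n
  have hs_log : (s.card : ℝ) * Real.log n ≤ n + 2 * n * Real.log q := by
    rcases n.eq_zero_or_pos with h0 | h0
    · simp [h0]
    have hq0 : (0 : ℝ) < q := by exact_mod_cast hq.pos
    have h1 : ((n : ℝ)) ^ s.card ≤ ((n : ℝ) + 1) * (q : ℝ) ^ (2 * n) := by exact_mod_cast hpow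
    have h2 := Real.log_le_log (by positivity) h1
    rw [Real.log_pow, Real.log_mul (by positivity) (by positivity), Real.log_pow] at h2
    have h3 := Real.log_le_sub_one_of_pos (show (0 : ℝ) < (n : ℝ) + 1 by positivity)
    push_cast at h2
    linarith
  have hcard' : (primesOneModCount q N : ℝ) ≤ Nat.primeCounting n + s.card := by
    exact_mod_cast hcard
  have := mul_le_mul_of_nonneg_right hcard' hlogn
  have := hC n
  nlinarith

/-- A bound for the primes `r ≡ 1 [MOD q]` that is uniform in `q`, weighted by `1 / q`. -/
lemma exists_primesOneModCount_div_mul_log_le :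
    ∃ C : ℝ, 0 ≤ C ∧ ∀ q N : ℕ, q.Prime →
      (primesOneModCount q N : ℝ) / q * Real.log N ≤ C * N * (q : ℝ) ^ (-(3 / 2) : ℝ) := by
  obtain ⟨C, hC0, hC⟩ := exists_primeCounting_mul_log_le
  refine ⟨4 * (C + 5), by positivity, fun q N hq => ?_⟩
  have hq0 : (0 : ℝ) < q := by exact_mod_cast hq.pos
  have hq1 : (1 : ℝ) ≤ q := by exact_mod_cast hq.one_le
  have hlogN := Real.log_natCast_nonneg N
  have hsplit : (q : ℝ) ^ (-(3 / 2) : ℝ) = (q : ℝ) ^ (1 / 2 : ℝ) * ((q : ℝ)⁻¹ * (q : ℝ)⁻¹) := by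
    rw [← Real.rpow_neg_one, ← Real.rpow_add hq0, ← Real.rpow_add hq0]
    norm_num
  have hhalf : 1 ≤ (q : ℝ) ^ (1 / 2 : ℝ) := Real.one_le_rpow hq1 (by norm_num)
  -- for `q ^ 2 ≤ N` the logarithms of `N` and `N / q` are comparable; for larger `q` the trivial
  -- bound `N / q` gains a power of `q` over `log N`
  rcases le_or_gt (q * q) N with hqN | hqN
  · set n := N / q with hn
    have hqn : q ≤ n := (Nat.le_div_iff_mul_le hq.pos).2 hqN
    have hn2 : 2 ≤ n := hq.two_le.trans hqn
    have hNn : N < n ^ 4 := by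
      have h1 : N < (n + 1) * q := by
        have := Nat.lt_div_mul_add (a := N) hq.pos
        rw [← hn] at this
        linarith
      have h2 : (n + 1) * q ≤ (n ^ 2) * n ^ 2 := by
        have : n + 1 ≤ n ^ 2 := by nlinarith
        have : q ≤ n ^ 2 := by nlinarith
        gcongr
      calc N < _ := h1
        _ ≤ _ := h2
        _ = n ^ 4 := by ring
    have hlog : Real.log N ≤ 4 * Real.log n := by
      have hN0 : 0 < N := lt_of_lt_of_le (Nat.mul_pos hq.pos hq.pos) hqN
      have h1 : (N : ℝ) ≤ (n : ℝ) ^ 4 := by exact_mod_cast hNn.le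
      have := Real.log_le_log (by exact_mod_cast hN0) h1
      rw [Real.log_pow] at this
      exact_mod_cast this
    have hnN : (n : ℝ) ≤ N * (q : ℝ)⁻¹ := by
      rw [← div_eq_mul_inv]
      exact Nat.cast_div_le
    have hlogq : Real.log q ≤ 2 * (q : ℝ) ^ (1 / 2 : ℝ) := by
      have := Real.log_le_rpow_div hq0.le (show (0 : ℝ) < 1 / 2 by norm_num)
      linarith
    have hmain := primesOneModCount_mul_log_le hC hq N
    rw [← hn] at hmain
    calc (primesOneModCount q N : ℝ) / q * Real.log N
        ≤ (primesOneModCount q N : ℝ) / q * (4 * Real.log n) := by gcongr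
      _ = 4 * (q : ℝ)⁻¹ * ((primesOneModCount q N : ℝ) * Real.log n) := by ring
      _ ≤ 4 * (q : ℝ)⁻¹ * ((C + 1 + 2 * Real.log q) * n) := by gcongr
      _ ≤ 4 * (q : ℝ)⁻¹ * (((C + 5) * (q : ℝ) ^ (1 / 2 : ℝ)) * (N * (q : ℝ)⁻¹)) := by
          gcongr
          nlinarith
      _ = _ := by rw [hsplit]; ring
  · have h1 : (primesOneModCount q N : ℝ) ≤ N * (q : ℝ)⁻¹ := by
      rw [← div_eq_mul_inv]
      exact (Nat.cast_le.2 (primesOneModCount_le_div q N)).trans Nat.cast_div_le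
    have h2 : Real.log N ≤ 4 * (q : ℝ) ^ (1 / 2 : ℝ) := by
      have h3 := Real.log_le_rpow_div N.cast_nonneg (show (0 : ℝ) < 1 / 4 by norm_num)
      have h4 : (N : ℝ) ^ (1 / 4 : ℝ) ≤ (q : ℝ) ^ (1 / 2 : ℝ) := by
        calc (N : ℝ) ^ (1 / 4 : ℝ) ≤ ((q : ℝ) ^ (2 : ℝ)) ^ (1 / 4 : ℝ) := by
              gcongr
              rw [Real.rpow_two, sq]
              exact_mod_cast hqN.le
          _ = _ := by rw [← Real.rpow_mul hq0.le]; norm_num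
      linarith
    calc (primesOneModCount q N : ℝ) / q * Real.log N
        ≤ (N * (q : ℝ)⁻¹) / q * (4 * (q : ℝ) ^ (1 / 2 : ℝ)) := by gcongr
      _ = 4 * N * (q : ℝ) ^ (-(3 / 2) : ℝ) := by rw [hsplit]; ring
      _ ≤ _ := by gcongr; linarith

/-- A substitute for the Brun–Titchmarsh inequality, weaker by a factor of order `log q`, which the
weight `1 / q` absorbs: the right-hand side is still summable over `q`. -/
theorem exists_eventually_primesOneModCount_div_le :
    ∃ C : ℝ, 0 ≤ C ∧ ∀ᶠ N : ℕ in atTop, ∀ q : ℕ, q.Prime →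
      (primesOneModCount q N : ℝ) / q / Nat.primeCounting N ≤
        C * (q : ℝ) ^ (-(3 / 2) : ℝ) := by
  obtain ⟨C, hC0, hC⟩ := exists_primesOneModCount_div_mul_log_le
  refine ⟨2 * C, by positivity, ?_⟩
  filter_upwards [tendsto_primeCounting_mul_log_div.eventually_const_lt
    (show (1 / 2 : ℝ) < 1 by norm_num), eventually_gt_atTop 1] with N hN hN1 q hq
  have hN0 : (0 : ℝ) < N := by exact_mod_cast hN1.trans' zero_lt_one
  have hlog : 0 < Real.log N := Real.log_pos (by exact_mod_cast hN1)
  rw [lt_div_iff₀ hN0] at hN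
  have hπ : 0 < (Nat.primeCounting N : ℝ) := by
    by_contra h
    have : (Nat.primeCounting N : ℝ) * Real.log N ≤ 0 :=
      mul_nonpos_of_nonpos_of_nonneg (not_lt.1 h) hlog.le
    linarith
  rw [div_le_iff₀ hπ]
  refine le_of_mul_le_mul_right ((hC q N hq).trans ?_) hlog
  have : 0 ≤ C * (q : ℝ) ^ (-(3 / 2) : ℝ) := by positivity
  nlinarith

/-! ### The mean value of `(φ(r - 1) / (r - 1)) ^ m` -/

/-- The factor of `(φ(n) / n) ^ m` at a prime `p` dividing `n`. -/
noncomputable def totientFactor (m p : ℕ) : ℝ := (1 - (p : ℝ)⁻¹) ^ m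

/-- The part of `(φ(n) / n) ^ m` coming from the primes `p ≤ z`. -/
noncomputable def truncatedTotientRatio (m z n : ℕ) : ℝ :=
  ∏ p ∈ primesUpTo z, if p ∣ n then totientFactor m p else 1

lemma totientFactor_nonneg (m : ℕ) {p : ℕ} (hp : p.Prime) : 0 ≤ totientFactor m p := by
  have : (p : ℝ)⁻¹ ≤ 1 := inv_le_one_of_one_le₀ (by exact_mod_cast hp.one_le)
  exact pow_nonneg (by linarith) m

lemma totientFactor_le_one (m : ℕ) {p : ℕ} (hp : p.Prime) : totientFactor m p ≤ 1 := by
  have : (p : ℝ)⁻¹ ≤ 1 := inv_le_one_of_one_le₀ (by exact_mod_cast hp.one_le)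
  have : (0 : ℝ) ≤ (p : ℝ)⁻¹ := by positivity
  exact pow_le_one₀ (by linarith) (by linarith)

lemma one_sub_totientFactor_le (m : ℕ) {p : ℕ} (hp : p.Prime) :
    1 - totientFactor m p ≤ m * (p : ℝ)⁻¹ := by
  have h1 : (p : ℝ)⁻¹ ≤ 1 := inv_le_one_of_one_le₀ (by exact_mod_cast hp.one_le)
  have := one_add_mul_le_pow (show (-2 : ℝ) ≤ -(p : ℝ)⁻¹ by linarith) m
  rw [totientFactor, sub_eq_add_neg 1 (p : ℝ)⁻¹]
  linarith

lemma totient_div_pow_eq {m N n : ℕ} (hn : n ≠ 0) (hnN : n ≤ N) :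
    ((n.totient : ℝ) / n) ^ m = truncatedTotientRatio m N n := by
  have h1 : (n.totient : ℝ) / n = ∏ p ∈ n.primeFactors, (1 - (p : ℝ)⁻¹) := by
    have h := congrArg (Rat.cast : ℚ → ℝ) (Nat.totient_eq_mul_prod_factors n)
    push_cast at h
    rw [h, mul_div_cancel_left₀ _ (by exact_mod_cast hn)]
  have h2 : n.primeFactors = (primesUpTo N).filter fun p => p ∣ n := by
    ext p
    simp only [primesUpTo, Nat.mem_primeFactors, Finset.mem_filter, Finset.mem_Icc]
    constructor
    · rintro ⟨hp, hd, -⟩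
      exact ⟨⟨⟨hp.one_le, (Nat.le_of_dvd (Nat.pos_of_ne_zero hn) hd).trans hnN⟩, hp⟩, hd⟩
    · rintro ⟨⟨-, hp⟩, hd⟩
      exact ⟨hp, hd, hn⟩
  rw [h1, ← Finset.prod_pow, h2, Finset.prod_filter]
  rfl

lemma one_sub_prod_le_sum_one_sub {ι : Type*} (s : Finset ι) {a : ι → ℝ}
    (h0 : ∀ i ∈ s, 0 ≤ a i) (h1 : ∀ i ∈ s, a i ≤ 1) :
    1 - ∏ i ∈ s, a i ≤ ∑ i ∈ s, (1 - a i) := by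
  classical
  induction s using Finset.induction_on with
  | empty => simp
  | insert i s hi ih =>
    rw [Finset.prod_insert hi, Finset.sum_insert hi]
    have hs : ∀ j ∈ s, j ∈ insert i s := fun j hj => Finset.mem_insert_of_mem hj
    have h2 := ih (fun j hj => h0 j (hs j hj)) fun j hj => h1 j (hs j hj)
    have h3 : ∏ j ∈ s, a j ≤ 1 :=
      Finset.prod_le_one (fun j hj => h0 j (hs j hj)) fun j hj => h1 j (hs j hj)
    have h4 := h1 i (Finset.mem_insert_self i s)
    nlinarith

lemma primesUpTo_mono {z N : ℕ} (h : z ≤ N) : primesUpTo z ⊆ primesUpTo N := by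
  refine Finset.filter_subset_filter _ (Finset.Icc_subset_Icc_right h)

lemma truncatedTotientRatio_nonneg (m z n : ℕ) : 0 ≤ truncatedTotientRatio m z n := by
  refine Finset.prod_nonneg fun p hp => ?_
  split_ifs
  exacts [totientFactor_nonneg m (prime_of_mem_primesUpTo hp), zero_le_one]

lemma abs_truncatedTotientRatio_sub_le {m z N : ℕ} (h : z ≤ N) (n : ℕ) :
    |truncatedTotientRatio m z n - truncatedTotientRatio m N n| ≤
      ∑ p ∈ primesUpTo N \ primesUpTo z, if p ∣ n then m * (p : ℝ)⁻¹ else 0 := by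
  set b : ℕ → ℝ := fun p => if p ∣ n then totientFactor m p else 1 with hb
  have hp : ∀ p ∈ primesUpTo N \ primesUpTo z, p.Prime := fun p hp =>
    prime_of_mem_primesUpTo (Finset.mem_sdiff.1 hp).1
  have hb0 : ∀ p, p.Prime → 0 ≤ b p := fun p hp => by
    simp only [hb]; split_ifs
    exacts [totientFactor_nonneg m hp, zero_le_one]
  have hb1 : ∀ p, p.Prime → b p ≤ 1 := fun p hp => by
    simp only [hb]; split_ifs
    exacts [totientFactor_le_one m hp, le_rfl]
  have hmul : truncatedTotientRatio m N n =
      (∏ p ∈ primesUpTo N \ primesUpTo z, b p) * truncatedTotientRatio m z n :=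
    (Finset.prod_sdiff (primesUpTo_mono h)).symm
  have hz0 := truncatedTotientRatio_nonneg m z n
  have hz1 : truncatedTotientRatio m z n ≤ 1 :=
    Finset.prod_le_one (fun p hp => hb0 p (prime_of_mem_primesUpTo hp))
      fun p hp => hb1 p (prime_of_mem_primesUpTo hp)
  have hle1 : ∏ p ∈ primesUpTo N \ primesUpTo z, b p ≤ 1 :=
    Finset.prod_le_one (fun p h => hb0 p (hp p h)) fun p h => hb1 p (hp p h)
  have hsum := one_sub_prod_le_sum_one_sub _ (fun p h => hb0 p (hp p h)) fun p h => hb1 p (hp p h)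
  have hsum' : ∑ p ∈ primesUpTo N \ primesUpTo z, (1 - b p) ≤
      ∑ p ∈ primesUpTo N \ primesUpTo z, if p ∣ n then m * (p : ℝ)⁻¹ else 0 := by
    refine Finset.sum_le_sum fun p h => ?_
    simp only [hb]
    split_ifs
    exacts [one_sub_totientFactor_le m (hp p h), by simp]
  rw [hmul, abs_of_nonneg (by nlinarith)]
  nlinarith

lemma totient_prod_primes {T : Finset ℕ} (hT : ∀ p ∈ T, p.Prime) :
    ((∏ p ∈ T, p).totient : ℝ) = ∏ p ∈ T, ((p : ℝ) - 1) := by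
  induction T using Finset.induction_on with
  | empty => simp
  | insert p T hp ih =>
    have hT' : ∀ q ∈ T, q.Prime := fun q hq => hT q (Finset.mem_insert_of_mem hq)
    have hpp := hT p (Finset.mem_insert_self p T)
    rw [Finset.prod_insert hp, Finset.prod_insert hp, Nat.totient_mul, Nat.totient_prime hpp]
    · push_cast [hpp.one_le]
      rw [← ih hT']
    · refine Nat.Coprime.prod_right fun q hq => (Nat.coprime_primes hpp (hT' q hq)).2 ?_
      rintro rfl
      exact hp hq

lemma sum_truncatedTotientRatio (m z N : ℕ) :
    ∑ r ∈ primesUpTo N, truncatedTotientRatio m z (r - 1) =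
      ∑ T ∈ (primesUpTo z).powerset,
        (∏ p ∈ T, (totientFactor m p - 1)) * primesOneModCount (∏ p ∈ T, p) N := by
  have h1 : ∀ n, truncatedTotientRatio m z n = ∑ T ∈ (primesUpTo z).powerset,
      if ∏ p ∈ T, p ∣ n then ∏ p ∈ T, (totientFactor m p - 1) else 0 := by
    intro n
    have h2 : truncatedTotientRatio m z n =
        ∏ p ∈ primesUpTo z, (1 + if p ∣ n then totientFactor m p - 1 else 0) := by
      refine Finset.prod_congr rfl fun p _ => ?_
      split_ifs <;> ring
    rw [h2, Finset.prod_one_add]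
    refine Finset.sum_congr rfl fun T hT => ?_
    rw [Finset.prod_ite_zero]
    congr 1
    have hT' := Finset.mem_powerset.1 hT
    rw [eq_iff_iff]
    refine ⟨fun h => Finset.prod_primes_dvd n
      (fun p hp => (prime_of_mem_primesUpTo (hT' hp)).prime) h, fun h p hp => ?_⟩
    exact (Finset.dvd_prod_of_mem (fun p => p) hp).trans h
  simp_rw [h1]
  rw [Finset.sum_comm]
  refine Finset.sum_congr rfl fun T _ => ?_
  rw [← Finset.sum_filter, Finset.sum_const, nsmul_eq_mul, mul_comm, primesOneModCount]

/-- For fixed `z` the truncated ratio is a finite combination of indicators of congruences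
`r ≡ 1 [MOD d]`, whose densities are `1 / φ(d)`. -/
lemma tendsto_truncated_average (m z : ℕ) :
    Tendsto (fun N => (∑ r ∈ primesUpTo N, truncatedTotientRatio m z (r - 1)) /
      (Nat.primeCounting N : ℝ)) atTop
      (𝓝 (∏ p ∈ primesUpTo z, (1 + (totientFactor m p - 1) / ((p : ℝ) - 1)))) := by
  simp_rw [sum_truncatedTotientRatio, Finset.sum_div, mul_div_assoc]
  rw [Finset.prod_one_add]
  refine tendsto_finsetSum _ fun T hT => ?_
  have hT' : ∀ p ∈ T, p.Prime := fun p hp => prime_of_mem_primesUpTo (Finset.mem_powerset.1 hT hp)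
  rw [Finset.prod_div_distrib, ← totient_prod_primes hT', div_eq_mul_inv]
  exact (tendsto_primesOneModCount_div
    (Finset.prod_ne_zero_iff.2 fun p hp => (hT' p hp).ne_zero)).const_mul _

/-- Truncation at `z` changes the averages by an amount that is small uniformly in `N`. -/
lemma eventually_abs_average_sub_le (m : ℕ) {ε : ℝ} (hε : 0 < ε) :
    ∀ᶠ z : ℕ in atTop, ∀ᶠ N : ℕ in atTop,
      |(∑ r ∈ primesUpTo N, truncatedTotientRatio m z (r - 1)) / (Nat.primeCounting N : ℝ) -
        (∑ r ∈ primesUpTo N, truncatedTotientRatio m N (r - 1)) / (Nat.primeCounting N : ℝ)| ≤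
          ε := by
  obtain ⟨C, hC0, hC⟩ := exists_eventually_primesOneModCount_div_le
  have hsum : Summable fun n : ℕ => (n : ℝ) ^ (-(3 / 2) : ℝ) :=
    Real.summable_nat_rpow.2 (by norm_num)
  obtain ⟨s, hs⟩ := summable_iff_vanishing_norm.1 hsum (ε / (m * C + 1)) (by positivity)
  filter_upwards [eventually_ge_atTop (s.sup id)] with z hz
  filter_upwards [hC, eventually_ge_atTop z] with N hN hzN
  set D := primesUpTo N \ primesUpTo z with hD
  have hDp : ∀ p ∈ D, p.Prime := fun p hp => prime_of_mem_primesUpTo (Finset.mem_sdiff.1 hp).1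
  have hdisj : Disjoint D s := by
    refine Finset.disjoint_left.2 fun p hp hps => (Finset.mem_sdiff.1 hp).2 ?_
    have h1 : p ≤ z := (Finset.le_sup (f := id) hps).trans hz
    exact Finset.mem_filter.2 ⟨Finset.mem_Icc.2 ⟨(hDp p hp).one_le, h1⟩, hDp p hp⟩
  have htail : ∑ p ∈ D, (p : ℝ) ^ (-(3 / 2) : ℝ) < ε / (m * C + 1) :=
    (le_abs_self _).trans_lt (hs D hdisj)
  rw [← sub_div, ← Finset.sum_sub_distrib, abs_div, Nat.abs_cast]
  calc |∑ r ∈ primesUpTo N, (truncatedTotientRatio m z (r - 1) -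
          truncatedTotientRatio m N (r - 1))| / (Nat.primeCounting N : ℝ)
      ≤ (∑ r ∈ primesUpTo N, ∑ p ∈ D, if p ∣ r - 1 then m * (p : ℝ)⁻¹ else 0) /
          (Nat.primeCounting N : ℝ) := by
        gcongr
        refine (Finset.abs_sum_le_sum_abs _ _).trans (Finset.sum_le_sum fun r _ => ?_)
        exact abs_truncatedTotientRatio_sub_le hzN _
    _ = ∑ p ∈ D, m * ((primesOneModCount p N : ℝ) / p / Nat.primeCounting N) := by
        rw [Finset.sum_comm, Finset.sum_div]
        refine Finset.sum_congr rfl fun p _ => ?_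
        rw [← Finset.sum_filter, Finset.sum_const, nsmul_eq_mul, primesOneModCount]
        ring
    _ ≤ ∑ p ∈ D, m * (C * (p : ℝ) ^ (-(3 / 2) : ℝ)) := by
        gcongr with p hp
        exact hN p (hDp p hp)
    _ = m * C * ∑ p ∈ D, (p : ℝ) ^ (-(3 / 2) : ℝ) := by
        rw [Finset.mul_sum]
        exact Finset.sum_congr rfl fun p _ => by ring
    _ ≤ m * C * (ε / (m * C + 1)) := by gcongr
    _ ≤ ε := by
        rw [mul_div_assoc', div_le_iff₀ (by positivity)]
        nlinarith

lemma sigmaFactor_eq (m : ℕ) (p : Nat.Primes) :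
    sigmaFactor m p = 1 + (totientFactor m p - 1) / (((p : ℕ) : ℝ) - 1) := by
  have hp : (1 : ℝ) < (p : ℕ) := by exact_mod_cast p.prop.one_lt
  have h1 : ((p : ℕ) : ℝ) - 1 ≠ 0 := by linarith
  have h0 : ((p : ℕ) : ℝ) ≠ 0 := by linarith
  have h2 : totientFactor m p = (((p : ℕ) : ℝ) - 1) ^ m / ((p : ℕ) : ℝ) ^ m := by
    rw [totientFactor, ← div_pow]
    congr 1
    field_simp
  have h3 : ((p : ℕ) : ℝ) ^ (m + 1) - ((p : ℕ) : ℝ) ^ m =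
      ((p : ℕ) : ℝ) ^ m * (((p : ℕ) : ℝ) - 1) := by ring
  rw [sigmaFactor, h2, h3]
  field_simp
  ring

lemma summable_norm_totientFactor (m : ℕ) : Summable fun p : Nat.Primes =>
    ‖(totientFactor m p - 1) / (((p : ℕ) : ℝ) - 1)‖ := by
  have h2 : Summable fun p : Nat.Primes => 2 * m * (((p : ℕ) : ℝ) ^ (-2 : ℝ)) :=
    (((Real.summable_nat_rpow.2 (by norm_num : (-2 : ℝ) < -1)).comp_injective
      Nat.Primes.coe_nat_injective)).mul_left _
  refine Summable.of_nonneg_of_le (fun p => norm_nonneg _) (fun p => ?_) h2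
  have hp : (2 : ℝ) ≤ (p : ℕ) := by exact_mod_cast p.prop.two_le
  have h3 := totientFactor_le_one m p.prop
  have h4 := one_sub_totientFactor_le m p.prop
  rw [norm_div, Real.norm_eq_abs, Real.norm_eq_abs, abs_of_nonpos (by linarith),
    abs_of_pos (by linarith), Real.rpow_neg (by linarith), Real.rpow_two,
    div_le_iff₀ (by linarith)]
  have h5 : (m : ℝ) * ((p : ℕ) : ℝ)⁻¹ ≤ 2 * m * (((p : ℕ) : ℝ) ^ 2)⁻¹ * (((p : ℕ) : ℝ) - 1) := by
    have h6 : ((p : ℕ) : ℝ)⁻¹ ≤ 2 * (((p : ℕ) : ℝ) ^ 2)⁻¹ * (((p : ℕ) : ℝ) - 1) := by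
      field_simp
      linarith
    have := mul_le_mul_of_nonneg_left h6 (Nat.cast_nonneg (α := ℝ) m)
    linarith
  linarith

theorem multipliable_sigmaFactor (m : ℕ) : Multipliable (sigmaFactor m) := by
  rw [funext (sigmaFactor_eq m)]
  exact multipliable_one_add_of_summable (summable_norm_totientFactor m)

lemma tendsto_prod_primesUpTo (m : ℕ) :
    Tendsto (fun z => ∏ p ∈ primesUpTo z, (1 + (totientFactor m p - 1) / ((p : ℝ) - 1))) atTop
      (𝓝 (sigmaMoment m)) := by
  have hmono : Monotone fun z => (primesUpTo z).subtype Nat.Prime := fun z N h =>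
    Finset.subtype_mono (primesUpTo_mono h)
  have hat : Tendsto (fun z => (primesUpTo z).subtype Nat.Prime) atTop atTop :=
    tendsto_atTop_finset_of_monotone hmono fun p => ⟨p, by
      have hp := p.prop
      simp [primesUpTo, hp, hp.one_le]⟩
  refine ((multipliable_sigmaFactor m).hasProd.comp hat).congr fun z => ?_
  simp only [Function.comp]
  rw [← Finset.prod_subtype_of_mem _ fun p hp => prime_of_mem_primesUpTo hp]
  exact Finset.prod_congr rfl fun p _ => sigmaFactor_eq m p

/-- `σ_m` is the mean value of `(φ(r - 1) / (r - 1)) ^ m` over the primes `r ≤ N`. -/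
theorem tendsto_average_primesUpTo (m : ℕ) :
    Tendsto (fun N => (∑ r ∈ primesUpTo N, ((Nat.totient (r - 1) : ℝ) / ((r : ℝ) - 1)) ^ m) /
      (Nat.primeCounting N : ℝ)) atTop (𝓝 (sigmaMoment m)) := by
  have heq : ∀ N, ∑ r ∈ primesUpTo N, ((Nat.totient (r - 1) : ℝ) / ((r : ℝ) - 1)) ^ m =
      ∑ r ∈ primesUpTo N, truncatedTotientRatio m N (r - 1) := fun N => by
    refine Finset.sum_congr rfl fun r hr => ?_
    have h2 := (prime_of_mem_primesUpTo hr).two_le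
    have hle := le_of_mem_primesUpTo hr
    rw [← totient_div_pow_eq (by omega) (by omega), Nat.cast_pred (by omega)]
  simp_rw [heq]
  rw [Metric.tendsto_nhds]
  intro ε hε
  obtain ⟨z, hz1, hz2⟩ := ((eventually_abs_average_sub_le m (show 0 < ε / 3 by positivity)).and
    (Metric.tendsto_nhds.1 (tendsto_prod_primesUpTo m) (ε / 3) (by positivity))).exists
  filter_upwards [hz1, Metric.tendsto_nhds.1 (tendsto_truncated_average m z) (ε / 3)
    (by positivity)] with N h1 h2
  rw [← Real.dist_eq, dist_comm] at h1
  exact (dist_triangle _ _ _).trans_lt ((add_lt_add_of_le_of_lt h1 ((dist_triangle _ _ _).trans_lt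
    (add_lt_add h2 hz2))).trans_eq (by ring))

/-! ### The product over primes -/

lemma primesUpTo_kthPrime {k : ℕ} (hk : 1 ≤ k) :
    primesUpTo (kthPrime k) = (Finset.range k).map ⟨Nat.nth Nat.Prime,
      Nat.nth_injective Nat.infinite_setOfPred_prime⟩ := by
  ext p
  simp only [primesUpTo, kthPrime, Finset.mem_filter, Finset.mem_Icc, Finset.mem_map,
    Finset.mem_range, Function.Embedding.coeFn_mk]
  constructor
  · rintro ⟨⟨-, hle⟩, hp⟩
    refine ⟨Nat.count Nat.Prime p, ?_, Nat.nth_count hp⟩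
    have := Nat.count_monotone Nat.Prime hle
    rw [Nat.count_nth_of_infinite Nat.infinite_setOfPred_prime] at this
    omega
  · rintro ⟨i, hi, rfl⟩
    have hp := Nat.prime_nth_prime i
    exact ⟨⟨hp.one_le, Nat.nth_monotone Nat.infinite_setOfPred_prime (by omega)⟩, hp⟩

lemma primeCounting_kthPrime {k : ℕ} (hk : 1 ≤ k) : Nat.primeCounting (kthPrime k) = k := by
  rw [← card_primesUpTo, primesUpTo_kthPrime hk]
  simp

lemma tendsto_kthPrime : Tendsto kthPrime atTop atTop :=
  (Nat.nth_strictMono Nat.infinite_setOfPred_prime).tendsto_atTop.comp (tendsto_sub_atTop_nat 1)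

theorem tendsto_average_kthPrime (m : ℕ) :
    Tendsto (fun k : ℕ => (∑ r ∈ primesUpTo (kthPrime k),
      ((Nat.totient (r - 1) : ℝ) / ((r : ℝ) - 1)) ^ m) / (k : ℝ)) atTop (𝓝 (sigmaMoment m)) := by
  refine ((tendsto_average_primesUpTo m).comp tendsto_kthPrime).congr' ?_
  filter_upwards [eventually_ge_atTop 1] with k hk
  simp only [Function.comp, primeCounting_kthPrime hk]

lemma totient_two_mul_le (k : ℕ) : (2 * k).totient ≤ k := by
  induction k using Nat.strong_induction_on with
  | _ k ih =>
    rcases k.even_or_odd' with ⟨j, rfl | rfl⟩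
    · rcases j.eq_zero_or_pos with rfl | hj
      · simp
      · rw [Nat.totient_two_mul_of_even (even_two_mul j)]
        exact Nat.mul_le_mul_left 2 (ih j (by omega))
    · rw [Nat.totient_two_mul_of_odd (odd_two_mul_add_one j)]
      exact Nat.totient_le _

/-- The ratio `φ(r - 1) / r` for the `i`-th prime `r`, counted from `0`. Unlike
`φ(r - 1) / (r - 1)`, which is `1` at `r = 2`, it is at most `1 / 2` for every prime, so that
`log (1 - φ(r - 1) / r)` can be expanded uniformly. -/
noncomputable def shiftedRatio (i : ℕ) : ℝ :=
  (Nat.totient (Nat.nth Nat.Prime i - 1) : ℝ) / (Nat.nth Nat.Prime i : ℝ)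

lemma shiftedRatio_nonneg (i : ℕ) : 0 ≤ shiftedRatio i := by
  unfold shiftedRatio; positivity

lemma shiftedRatio_le_half (i : ℕ) : shiftedRatio i ≤ 1 / 2 := by
  unfold shiftedRatio
  have hp := Nat.prime_nth_prime i
  set r := Nat.nth Nat.Prime i
  have h0 : (0 : ℝ) < r := by exact_mod_cast hp.pos
  rw [div_le_div_iff₀ h0 two_pos]
  suffices h : (r - 1).totient * 2 ≤ 1 * r by exact_mod_cast h
  rcases hp.eq_two_or_odd' with h2 | hodd
  · simp [h2]
  · obtain ⟨k, hk⟩ := hodd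
    have hk0 : r - 1 = 2 * k := by omega
    rw [hk0]
    have := totient_two_mul_le k
    omega

lemma tendsto_average_shiftedRatio (m : ℕ) :
    Tendsto (fun k : ℕ => (k : ℝ)⁻¹ * ∑ i ∈ Finset.range k, shiftedRatio i ^ m) atTop
      (𝓝 (sigmaMoment m)) := by
  set y : ℕ → ℝ := fun i =>
    (Nat.totient (Nat.nth Nat.Prime i - 1) : ℝ) / ((Nat.nth Nat.Prime i : ℝ) - 1) with hy
  have hdiff : Tendsto (fun i => shiftedRatio i ^ m - y i ^ m) atTop (𝓝 0) := by
    have hr : Tendsto (fun i => m * (Nat.nth Nat.Prime i : ℝ)⁻¹) atTop (𝓝 0) := by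
      have := (tendsto_inv_atTop_zero.comp ((tendsto_natCast_atTop_atTop (R := ℝ)).comp
        (Nat.nth_strictMono Nat.infinite_setOfPred_prime).tendsto_atTop)).const_mul (m : ℝ)
      simpa [Function.comp_def] using this
    refine squeeze_zero_norm (fun i => ?_) hr
    have hp := Nat.prime_nth_prime i
    have h2 : (2 : ℝ) ≤ Nat.nth Nat.Prime i := by exact_mod_cast hp.two_le
    set r := Nat.nth Nat.Prime i with hr
    have hy0 : 0 ≤ y i := div_nonneg (Nat.cast_nonneg _) (by linarith)
    have hy1 : y i ≤ 1 := by
      refine div_le_one_of_le₀ ?_ (by linarith)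
      rw [← Nat.cast_pred hp.pos]
      exact_mod_cast Nat.totient_le _
    have hs : shiftedRatio i = totientFactor 1 r * y i := by
      have h1 : (r : ℝ) - 1 ≠ 0 := by linarith
      have h0 : (r : ℝ) ≠ 0 := by linarith
      simp only [shiftedRatio, totientFactor, hy, ← hr]
      field_simp
    have hs' : shiftedRatio i ^ m = totientFactor m r * y i ^ m := by
      rw [hs, mul_pow, totientFactor, totientFactor, pow_one]
    have h3 := one_sub_totientFactor_le m hp
    have h4 := totientFactor_le_one m hp
    have h5 : y i ^ m ≤ 1 := pow_le_one₀ hy0 hy1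
    have h6 : 0 ≤ y i ^ m := pow_nonneg hy0 m
    rw [hs', Real.norm_eq_abs, abs_of_nonpos (by nlinarith)]
    nlinarith
  have h1 := hdiff.cesaro
  have h2 := h1.add (tendsto_average_kthPrime m)
  rw [zero_add] at h2
  refine h2.congr' ?_
  filter_upwards [eventually_ge_atTop 1] with k hk
  rw [primesUpTo_kthPrime hk, Finset.sum_map, Finset.sum_sub_distrib]
  simp only [Function.Embedding.coeFn_mk, hy]
  ring

lemma sigmaMoment_nonneg (m : ℕ) : 0 ≤ sigmaMoment m :=
  ge_of_tendsto' (tendsto_average_shiftedRatio m) fun _ =>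
    mul_nonneg (by positivity) (Finset.sum_nonneg fun i _ => pow_nonneg (shiftedRatio_nonneg i) m)

lemma average_shiftedRatio_le (m k : ℕ) :
    (k : ℝ)⁻¹ * ∑ i ∈ Finset.range k, shiftedRatio i ^ m ≤ (1 / 2) ^ m := by
  have h1 : ∑ i ∈ Finset.range k, shiftedRatio i ^ m ≤ ∑ i ∈ Finset.range k, (1 / 2 : ℝ) ^ m :=
    Finset.sum_le_sum fun i _ => pow_le_pow_left₀ (shiftedRatio_nonneg i) (shiftedRatio_le_half i) m
  rw [Finset.sum_const, Finset.card_range, nsmul_eq_mul] at h1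
  refine inv_mul_le_of_le_mul₀ (Nat.cast_nonneg k) (by positivity) ?_
  linarith

lemma sigmaMoment_le (m : ℕ) : sigmaMoment m ≤ (1 / 2) ^ m :=
  le_of_tendsto' (tendsto_average_shiftedRatio m) fun k => average_shiftedRatio_le m k

lemma sigmaMoment_one_pos : 0 < sigmaMoment 1 := by
  refine lt_of_le_of_ne (sigmaMoment_nonneg 1) (Ne.symm ?_)
  rw [sigmaMoment, funext (sigmaFactor_eq 1)]
  refine tprod_one_add_ne_zero_of_summable (fun p => ne_of_gt ?_) (summable_norm_totientFactor 1)
  have hp : (2 : ℝ) ≤ (p : ℕ) := by exact_mod_cast p.prop.two_le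
  have h1 : (0 : ℝ) < ((p : ℕ) : ℝ) - 1 := by linarith
  have h3 : ((p : ℕ) : ℝ)⁻¹ ≤ 1 / 2 := by
    rw [one_div]
    exact inv_anti₀ two_pos hp
  rw [totientFactor, pow_one, ← neg_lt_iff_pos_add', lt_div_iff₀ h1]
  linarith

lemma summable_sigmaMoment_div :
    Summable fun m : ℕ => sigmaMoment (m + 1) / ((m : ℝ) + 1) := by
  refine Summable.of_nonneg_of_le
    (fun m => div_nonneg (sigmaMoment_nonneg _) (by positivity)) (fun m => ?_)
    ((summable_nat_add_iff 1).2 (summable_geometric_of_lt_one (r := (1 / 2 : ℝ)) (by norm_num)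
      (by norm_num)))
  exact (div_le_self (sigmaMoment_nonneg _) (by linarith [m.cast_nonneg (α := ℝ)])).trans
    (sigmaMoment_le _)

/-- Expanding the logarithm and exchanging the limit with the sum over `m`. -/
lemma tendsto_average_neg_log :
    Tendsto (fun k : ℕ => (k : ℝ)⁻¹ * ∑ i ∈ Finset.range k, -Real.log (1 - shiftedRatio i)) atTop
      (𝓝 (∑' m : ℕ, sigmaMoment (m + 1) / ((m : ℝ) + 1))) := by
  have h1 : ∀ k : ℕ, (k : ℝ)⁻¹ * ∑ i ∈ Finset.range k, -Real.log (1 - shiftedRatio i) =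
      ∑' m : ℕ, ((k : ℝ)⁻¹ * ∑ i ∈ Finset.range k, shiftedRatio i ^ (m + 1)) / ((m : ℝ) + 1) := by
    intro k
    have h2 : ∀ i ∈ Finset.range k, HasSum (fun m : ℕ => shiftedRatio i ^ (m + 1) / ((m : ℝ) + 1))
        (-Real.log (1 - shiftedRatio i)) := fun i _ =>
      Real.hasSum_pow_div_log_of_abs_lt_one (by
        rw [abs_of_nonneg (shiftedRatio_nonneg i)]
        linarith [shiftedRatio_le_half i])
    rw [← ((hasSum_sum h2).mul_left (k : ℝ)⁻¹).tsum_eq]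
    refine tsum_congr fun m => ?_
    rw [mul_div_assoc, Finset.sum_div]
  simp_rw [h1]
  refine tendsto_tsum_of_dominated_convergence (bound := fun m : ℕ => (1 / 2 : ℝ) ^ (m + 1))
    ((summable_nat_add_iff 1).2 (summable_geometric_of_lt_one (by norm_num) (by norm_num)))
    (fun m => (tendsto_average_shiftedRatio (m + 1)).div_const _)
    (Eventually.of_forall fun k m => ?_)
  have h0 : 0 ≤ (k : ℝ)⁻¹ * ∑ i ∈ Finset.range k, shiftedRatio i ^ (m + 1) :=
    mul_nonneg (by positivity) (Finset.sum_nonneg fun i _ => pow_nonneg (shiftedRatio_nonneg i) _)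
  rw [Real.norm_of_nonneg (div_nonneg h0 (by positivity))]
  exact (div_le_self h0 (by linarith [m.cast_nonneg (α := ℝ)])).trans
    (average_shiftedRatio_le _ _)

theorem mainTheorem7 :
    (∀ m : ℕ, 1 ≤ m →
      Multipliable (sigmaFactor m) ∧
      Tendsto
        (fun k : ℕ => (∑ r ∈ primesUpTo (kthPrime k),
          ((Nat.totient (r - 1) : ℝ) / ((r : ℝ) - 1)) ^ m) / (k : ℝ))
        atTop (𝓝 (sigmaMoment m))) ∧
    ∃ ϱ : ℝ, 1 < ϱ ∧
      HasSum (fun m : ℕ => sigmaMoment (m + 1) / ((m : ℝ) + 1)) (Real.log ϱ) ∧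
      ∃ ε : ℕ → ℝ, Tendsto ε atTop (𝓝 0) ∧
        ∀ k : ℕ, 1 ≤ k →
          ∏ r ∈ primesUpTo (kthPrime k), (1 - (Nat.totient (r - 1) : ℝ) / (r : ℝ)) =
            ϱ ^ (-(1 + ε k) * (k : ℝ)) := by
  refine ⟨fun m _ => ⟨multipliable_sigmaFactor m, tendsto_average_kthPrime m⟩, ?_⟩
  set l := ∑' m : ℕ, sigmaMoment (m + 1) / ((m : ℝ) + 1) with hl
  have hlpos : 0 < l := by
    refine summable_sigmaMoment_div.tsum_pos
      (fun m => div_nonneg (sigmaMoment_nonneg _) (by positivity)) 0 ?_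
    simpa using sigmaMoment_one_pos
  set a : ℕ → ℝ := fun k => (k : ℝ)⁻¹ * ∑ i ∈ Finset.range k, -Real.log (1 - shiftedRatio i)
    with ha
  refine ⟨Real.exp l, Real.one_lt_exp_iff.2 hlpos, ?_, fun k => a k / l - 1, ?_, fun k hk => ?_⟩
  · rw [Real.log_exp]
    exact summable_sigmaMoment_div.hasSum
  · have := (tendsto_average_neg_log.div_const l).sub_const 1
    rwa [← hl, div_self hlpos.ne', sub_self] at this
  · have hpos : ∀ i, 0 < 1 - shiftedRatio i := fun i => by linarith [shiftedRatio_le_half i]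
    have hk0 : (k : ℝ) ≠ 0 := by positivity
    have hexp : l * (-(1 + (a k / l - 1)) * k) =
        ∑ i ∈ Finset.range k, Real.log (1 - shiftedRatio i) := by
      have : l * (-(1 + (a k / l - 1)) * k) = -(a k * k) := by field_simp; ring
      rw [this, ha]
      simp only [Finset.sum_neg_distrib]
      field_simp
    rw [← Real.exp_mul, hexp, Real.exp_sum, primesUpTo_kthPrime hk, Finset.prod_map]
    refine Finset.prod_congr rfl fun i _ => ?_
    rw [Real.exp_log (hpos i)]
    rfl
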